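/- Consider the delayed KPP--Fisher equation $$u_t(t,x)=\Delta u(t,x)+u(t,x)\,(1-u(t-h,x)),\qquad u\ge 0,\ x\in\mathbb R^m,\ h\ge 0. \quad (*)$$ Let $u(t,x)=\varphi(\nu\cdot x+ct)$, $|\nu|=1$, be a positive monotone traveling front of $(*)$, i.e. a classical solution whose profile $\varphi$ is positive, monotone, and satisfies $\varphi(-\infty)=0$, $\varphi(+\infty)=1$. Set $\phi(s):=\varphi(cs)$ and $\epsilon:=c^{-2}$. For $c\ge 2$ let $0<\lambda\le\mu$ be the roots of $\epsilon z^2-z+1=0$. Let $\lambda_1\le\lambda_2<0$ be the negative zeros, counted with multiplicity, of $\psi(z,\epsilon)=\epsilon z^2-z-e^{-zh}$ (for $h=0$ there is only one negative zero, denoted by $\lambda_2$). Critical values. Let $h_1=0.56077\dots$ be the positive root of $2h^2\exp(1+\sqrt{1+4h^2}-2h)=1+\sqrt{1+4h^2}$. For $h>1/e$ let $\epsilon^*(h)$ be given parametrically by $$\epsilon^*(h(t))=t\,h(t),\quad h(t)=\bigl(2t+\sqrt{4t^2+1}\bigr)\exp\Bigl(-1-\tfrac{2t}{1+\sqrt{4t^2+1}}\Bigr),\quad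 t\ge 0 ,$$ and set $c^*(h)=+\infty$ if $h\le 1/e$, $c^*(h)=1/\sqrt{\epsilon^*(h)}$ if $1/e<h\le h_1$. For $h>\frac12\ln2$ let $\epsilon^\#(h)$ be given parametrically by $$\epsilon^\#(h(t))=\frac{t+2+\sqrt{2t+4}}{t^2},\quad h(t)=-\frac{\ln(2+\sqrt{2t+4})}{t},\quad t\in(-2,0),$$ let $h_0=0.53366\dots$ be the value of $h$ with $\epsilon^\#(h_0)=1/4$, and set $c^\#(h)=+\infty$ if $0\le h\le \frac12\ln 2$, $c^\#(h)=1/\sqrt{\epsilon^\#(h)}$ if $\frac12\ln2<h\le h_0$, and $c^\#(h)=2$ if $h>h_0$. (I) At $-\infty$: there are $t_0\in\mathbb R$ and positive constants $K_1,K_2$ such that for every sufficiently small $\sigma>0$, as $t\to-\infty$, $$\phi(t+t_0)=\begin{cases}-K_2te^{\lambda t}+O(e^{(2\lambda-\sigma)t}), & c=2,\\ e^{\lambda t}-K_1e^{\mu t}+O(e^{(2\lambda-\sigma)t}), & 2<c<1.5\sqrt2,\\ e^{\lambda t}+O(e^{(2\lambda-\sigma)t}), & c\ge 1.5\sqrt2.\end{cases}$$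 (II) At $+\infty$: there are $t_0\in\mathbb R$ (in general different from the one in (I)) and positive constants $K_3,K_4$ such that for every sufficiently small $\sigma>0$, as $t\to+\infty$, $$\phi(t+t_0)=\begin{cases}1-e^{\lambda_2t}+O(e^{(2\lambda_2+\sigma)t}), & h\le h_0,\ c\in[2,c^\#(h)]\cap\mathbb R,\\ 1-e^{\lambda_2t}+K_3e^{\lambda_1t}+O(e^{(\lambda_1-\sigma)t}), & h\in(\frac12\ln2,h_1],\ c\in(c^\#(h),c^*(h)),\\ 1-K_4te^{\lambda_2t}+O(e^{(\lambda_2-\sigma)t}), & h\in(1/e,h_1],\ c=c^*(h).\end{cases}$$ -/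

import Mathlib

open Filter Topology Asymptotics

noncomputable section

namespace DelayedKPP

/-- The Euclidean space `ℝ^m`. -/
abbrev Space (m : ℕ) : Type := EuclideanSpace ℝ (Fin m)

/-- `u` is a non-negative classical solution, for all times `t ∈ ℝ`, of the delayed KPP-Fisher
equation `u_t(t,x) = Δ u(t,x) + u(t,x) (1 - u(t-h,x))`, `u ≥ 0`, `x ∈ ℝ^m`. -/
structure IsClassicalSolution {m : ℕ} (h : ℝ) (u : ℝ → Space m → ℝ) : Prop where
  contDiff_time : ∀ x, ContDiff ℝ 1 (fun t => u t x)
  contDiff_space : ∀ t, ContDiff ℝ 2 (u t)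
  nonneg : ∀ t x, 0 ≤ u t x
  equation : ∀ t x,
    deriv (fun s => u s x) t
      = Laplacian.laplacian (u t) x + u t x * (1 - u (t - h) x)

/-- `u(t,x) = φ(ν·x + c t)`, `|ν| = 1`, is a positive monotone traveling front (connecting `0`
with `1`) of the delayed KPP-Fisher equation with delay `h`; `φ` is its profile and `c` its
velocity. -/
structure IsPositiveMonotoneFront {m : ℕ} (h c : ℝ) (ν : Space m) (φ : ℝ → ℝ) : Prop where
  norm_direction : ‖ν‖ = 1
  solution : IsClassicalSolution h (fun t (x : Space m) => φ (inner ℝ ν x + c * t))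
  pos : ∀ s, 0 < φ s
  monotone : Monotone φ
  tendsto_atBot : Tendsto φ atBot (𝓝 0)
  tendsto_atTop : Tendsto φ atTop (𝓝 1)

/-- The parameter `ε = c⁻²`. -/
def eps (c : ℝ) : ℝ := 1 / c ^ 2

/-- The smaller root `λ` of `ε z² - z + 1 = 0`, where `ε = c⁻²` and `c ≥ 2`. -/
def lam (c : ℝ) : ℝ := (1 - √(1 - 4 * eps c)) / (2 * eps c)

/-- The larger root `μ` of `ε z² - z + 1 = 0`, where `ε = c⁻²` and `c ≥ 2`. -/
def mu (c : ℝ) : ℝ := (1 + √(1 - 4 * eps c)) / (2 * eps c)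

/-- The characteristic function `ψ(z, ε) = ε z² - z - exp(-z h)` at the positive steady state. -/
def psi (h ε z : ℝ) : ℝ := ε * z ^ 2 - z - Real.exp (-(z * h))

/-- The set of negative zeros of the characteristic function for the velocity `c`. Since the third
derivative of `ψ` is non-negative and `ψ` has a positive zero, it has at most two elements. -/
def negZeros (h c : ℝ) : Set ℝ := {z | z < 0 ∧ psi h (eps c) z = 0}

/-- The smaller negative zero `λ₁ ≤ λ₂` (for `h > 0`); it equals `λ₂` if the zero is double. -/
def lam1 (h c : ℝ) : ℝ := sInf (negZeros h c)

/-- The larger negative zero `λ₂`. -/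
def lam2 (h c : ℝ) : ℝ := sSup (negZeros h c)

/-- The critical delay `h₁ = 0.560771160…`: the positive root of
`2 h² exp(1 + √(1 + 4h²) - 2h) = 1 + √(1 + 4h²)`. -/
def h1 : ℝ :=
  sInf {h | 0 < h ∧
    2 * h ^ 2 * Real.exp (1 + √(1 + 4 * h ^ 2) - 2 * h) = 1 + √(1 + 4 * h ^ 2)}

/-- The delay along the curve `ε = ε^*(h)`, as a (strictly increasing) function of `t ≥ 0`. -/
def hStarPar (t : ℝ) : ℝ :=
  (2 * t + √(4 * t ^ 2 + 1)) * Real.exp (-1 - 2 * t / (1 + √(4 * t ^ 2 + 1)))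

/-- The function `ε^*`, defined parametrically by `ε^*(h(t)) = t h(t)`, `t ≥ 0`. The parameters
`t ∈ [0, 0.445…]` are those with `h(t) ∈ [1/e, h₁]`. -/
def epsStar (h : ℝ) : ℝ :=
  Function.invFunOn hStarPar (Set.Ici 0) h * h

/-- The critical velocity `c^*(h) ∈ (0, +∞]`: `+∞` for `h ≤ 1/e` and `1/√(ε^*(h))` for
`1/e < h ≤ h₁`. -/
def cStar (h : ℝ) : EReal :=
  if h ≤ Real.exp (-1) then ⊤ else ((1 / √(epsStar h) : ℝ) : EReal)

/-- The value of `ε` along the curve `ε = ε^#(h)`, for `t ∈ (-2, 0)`; strictly increasing. -/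
def epsSharpPar (t : ℝ) : ℝ := (t + 2 + √(2 * t + 4)) / t ^ 2

/-- The delay along the curve `ε = ε^#(h)`, for `t ∈ (-2, 0)`; strictly increasing. -/
def hSharpPar (t : ℝ) : ℝ := -(Real.log (2 + √(2 * t + 4)) / t)

/-- The function `ε^#`, defined parametrically by `ε^#(h(t)) = (t + 2 + √(2t + 4)) / t²`. The
parameters `t ∈ (-2, -1.806…]` are those with `ε^# ≤ 1/4`. -/
def epsSharp (h : ℝ) : ℝ :=
  epsSharpPar (Function.invFunOn hSharpPar (Set.Ioo (-2) 0) h)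

/-- The delay `h₀ = 0.5336619208…`: the value of `h` at which the curve `ε = ε^#(h)` reaches
`ε = 1/4`. -/
def h0 : ℝ := hSharpPar (Function.invFunOn epsSharpPar (Set.Ioo (-2) 0) (1 / 4))

/-- The velocity `c^#(h) ∈ (0, +∞]`: `+∞` for `h ≤ 0.5 ln 2`, `1/√(ε^#(h))` for
`0.5 ln 2 < h ≤ h₀`, and `2` for `h > h₀`. -/
def cSharp (h : ℝ) : EReal :=
  if h ≤ Real.log 2 / 2 then ⊤
  else if h ≤ h0 then ((1 / √(epsSharp h) : ℝ) : EReal)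
  else 2

end DelayedKPP

end

open DelayedKPP

namespace DelayedKPP

/-! At both ends the delay equation is reduced to first-order equations `y' = a y + f`, and the
signs of the leading coefficients come from monotone quantities.

At `-∞` let `λ ≤ μ` be the roots of `ε z² - z + 1`. Then `p = w' - λ w` satisfies `p' = μ p + w w(·
- h) / ε`. Since `p` is bounded and the forcing is positive, `p < 0`. Hence `exp (-λ t) w`
decreases, so a finite limit of it at `-∞` is positive, while `exp (-μ t) p` increases and its limit
there is negative. The forcing is quadratic, so each known decay rate doubles, up to the rate `λ` of
the linear part. The three cases are `μ = λ` (resonance), `λ < μ < 2λ`, and `μ ≥ 2λ`, where the `μ`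
term is absorbed in the error.

At `+∞` let `a = λ₂` and let `b > 0` be a positive zero of `psi`. Dividing `psi` by `(z - a)(z - b)`
leaves `ε - ∫ k(r) exp (-z r) dr` with `k ≥ 0` on `[0, h]` (`quot_mul`). Therefore `f = (D - a)(D -
b)(1 - w)` solves a renewal equation with nonnegative kernel `k / ε` and forcing minus a quadratic
term. As `psi` is negative at `0`, the kernel has mass below one. This gives `f ≤ 0`, and
integrating twice shows that `exp (-a t) (1 - w)` is nondecreasing (`IsProfile.deficit₂_le`,
`IsProfile.deficit₁_nonneg`).

For `h > 0` the quotient is strictly increasing, so it has at most one real zero, which is `λ₁` when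
`psi` has two negative zeros (or a double one). If the quotient is positive on `(2a, ∞)`, then `f`
decays at every rate above `2a`, and only `exp (a t)` survives. If its zero `z` lies in `(2a, a]`,
then `f ~ L exp (z t)` with `L < 0` (`renewal_tendsto`), which produces the second term, or the
resonant one when `z = a`.

The curve `ε^#` consists of parameters with zeros `z` and `2z`, the curve `ε^*` of those with a
double zero. Since `psi` increases with `ε`, comparing `c` with `c^#` and `c^*` decides the case. -/

/-! ### First-order linear equations with exponentially bounded forcing. -/

theorem isBigO_exp_atTop {b b' : ℝ} (h : b ≤ b') :
    (fun t => Real.exp (b * t)) =O[atTop] fun t => Real.exp (b' * t) := by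
  refine IsBigO.of_bound 1 ?_
  filter_upwards [eventually_ge_atTop 0] with t ht
  rw [Real.norm_of_nonneg (Real.exp_pos _).le, Real.norm_of_nonneg (Real.exp_pos _).le, one_mul]
  exact Real.exp_le_exp.2 (mul_le_mul_of_nonneg_right h ht)

theorem isBigO_exp_atBot {b b' : ℝ} (h : b' ≤ b) :
    (fun t => Real.exp (b * t)) =O[atBot] fun t => Real.exp (b' * t) := by
  refine IsBigO.of_bound 1 ?_
  filter_upwards [eventually_le_atBot 0] with t ht
  rw [Real.norm_of_nonneg (Real.exp_pos _).le, Real.norm_of_nonneg (Real.exp_pos _).le, one_mul]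
  exact Real.exp_le_exp.2 (mul_le_mul_of_nonpos_right h ht)

theorem hasDerivAt_exp_mul (a t : ℝ) :
    HasDerivAt (fun t => Real.exp (a * t)) (a * Real.exp (a * t)) t := by
  have := ((hasDerivAt_id t).const_mul a).exp
  simpa [mul_comm] using this

theorem exp_neg_mul_mul_exp (a t : ℝ) : Real.exp (-a * t) * Real.exp (a * t) = 1 := by
  rw [← Real.exp_add]; simp

/-- The derivative of `exp (-a t) y` when `y' = a y + f`. -/
theorem hasDerivAt_exp_neg_mul {a t : ℝ} {y f : ℝ → ℝ} (hy : HasDerivAt y (a * y t + f t) t) :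
    HasDerivAt (fun t => Real.exp (-a * t) * y t) (Real.exp (-a * t) * f t) t := by
  refine ((hasDerivAt_exp_mul (-a) t).mul hy).congr_deriv ?_
  ring

theorem exists_bound_of_isBigO_exp {b : ℝ} {f : ℝ → ℝ}
    (hf : f =O[atTop] fun t => Real.exp (b * t)) :
    ∃ M > 0, ∃ T ≥ 0, ∀ t ≥ T, |f t| ≤ M * Real.exp (b * t) := by
  obtain ⟨M, hM, h⟩ := hf.exists_pos
  obtain ⟨T, hT⟩ := eventually_atTop.1 h.bound
  refine ⟨M, hM, max T 0, le_max_right _ _, fun t ht => ?_⟩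
  simpa [Real.norm_eq_abs, abs_of_pos (Real.exp_pos _)] using hT t ((le_max_left _ _).trans ht)

/-- A substitute for `|∫ v'| ≤ ∫ e` that needs no integrability of `v'`: both `E - v` and `E + v`
are nondecreasing on `[T, ∞)`. -/
theorem abs_sub_le_of_deriv_bound {v v' E e : ℝ → ℝ} {T : ℝ}
    (hv : ∀ t, HasDerivAt v (v' t) t) (hE : ∀ t, HasDerivAt E (e t) t)
    (hb : ∀ t ≥ T, |v' t| ≤ e t) {s t : ℝ} (hs : T ≤ s) (hst : s ≤ t) :
    |v t - v s| ≤ E t - E s := by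
  have h1 : MonotoneOn (fun x => E x - v x) (Set.Ici T) := by
    apply monotoneOn_of_deriv_nonneg (convex_Ici T)
    · exact fun x _ => ((hE x).sub (hv x)).continuousAt.continuousWithinAt
    · exact fun x _ => ((hE x).sub (hv x)).differentiableAt.differentiableWithinAt
    · intro x hx
      rw [interior_Ici] at hx
      have : deriv (fun x => E x - v x) x = e x - v' x := ((hE x).sub (hv x)).deriv
      rw [this]
      linarith [hb x (le_of_lt hx), le_abs_self (v' x)]
  have h2 : MonotoneOn (fun x => E x + v x) (Set.Ici T) := by
    apply monotoneOn_of_deriv_nonneg (convex_Ici T)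
    · exact fun x _ => ((hE x).add (hv x)).continuousAt.continuousWithinAt
    · exact fun x _ => ((hE x).add (hv x)).differentiableAt.differentiableWithinAt
    · intro x hx
      rw [interior_Ici] at hx
      have : deriv (fun x => E x + v x) x = e x + v' x := ((hE x).add (hv x)).deriv
      rw [this]
      linarith [hb x (le_of_lt hx), neg_abs_le (v' x)]
  have h1 := h1 hs (hs.trans hst) hst
  have h2 := h2 hs (hs.trans hst) hst
  simp only at h1 h2
  rw [abs_le]
  constructor <;> linarith

theorem abs_exp_neg_mul_mul_le {a b M t x : ℝ} (h : |x| ≤ M * Real.exp (b * t)) :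
    |Real.exp (-a * t) * x| ≤ M * Real.exp ((b - a) * t) := by
  rw [abs_mul, abs_of_pos (Real.exp_pos _)]
  calc _ ≤ Real.exp (-a * t) * (M * Real.exp (b * t)) := by gcongr
    _ = M * (Real.exp (-a * t) * Real.exp (b * t)) := by ring
    _ = _ := by rw [← Real.exp_add]; ring_nf

theorem hasDerivAt_div_mul_exp {M d : ℝ} (hd : d ≠ 0) (t : ℝ) :
    HasDerivAt (fun t => M / d * Real.exp (d * t)) (M * Real.exp (d * t)) t := by
  refine ((hasDerivAt_exp_mul d t).const_mul (M / d)).congr_deriv ?_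
  field_simp

theorem tendsto_exp_mul_atTop_zero {d : ℝ} (hd : d < 0) :
    Tendsto (fun t => Real.exp (d * t)) atTop (𝓝 0) :=
  Real.tendsto_exp_atBot.comp (tendsto_id.const_mul_atTop_of_neg hd)

theorem tendsto_exp_mul_atBot_zero {d : ℝ} (hd : 0 < d) :
    Tendsto (fun t => Real.exp (d * t)) atBot (𝓝 0) :=
  Real.tendsto_exp_atBot.comp (tendsto_id.const_mul_atBot hd)

/-- Solutions of `y' = a y + f` with forcing of smaller exponential order than `exp (a t)`. -/
theorem exists_isBigO_sub_exp_atTop {a : ℝ} {y f : ℝ → ℝ}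
    (hy : ∀ t, HasDerivAt y (a * y t + f t) t)
    (hf : ∃ b < a, f =O[atTop] fun t => Real.exp (b * t)) :
    ∃ C, Tendsto (fun t => Real.exp (-a * t) * y t) atTop (𝓝 C) ∧
      ∀ b < a, (f =O[atTop] fun t => Real.exp (b * t)) →
        (fun t => y t - C * Real.exp (a * t)) =O[atTop] fun t => Real.exp (b * t) := by
  -- Since `b < a`, the derivative of `exp (-a t) y` has an integrable tail. One admissible rate
  -- yields the limit `C`; every other rate is then obtained by letting `t → ∞` in this estimate.
  have key : ∀ b < a, (f =O[atTop] fun t => Real.exp (b * t)) → ∃ M > 0, ∃ T, ∀ s ≥ T, ∀ t ≥ s,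
      |Real.exp (-a * t) * y t - Real.exp (-a * s) * y s| ≤ M * Real.exp ((b - a) * s) := by
    intro b hb hf
    obtain ⟨M, hM, T, -, h⟩ := exists_bound_of_isBigO_exp hf
    have hd : 0 < a - b := by linarith
    refine ⟨M / (a - b), by positivity, T, fun s hs t hst => ?_⟩
    have := abs_sub_le_of_deriv_bound (T := T) (fun t => hasDerivAt_exp_neg_mul (hy t))
      (fun t => hasDerivAt_div_mul_exp (M := M) (d := b - a) (by linarith) t)
      (fun t ht => abs_exp_neg_mul_mul_le (h t ht)) hs hst
    refine this.trans ?_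
    have e : M / (b - a) = -(M / (a - b)) := by rw [← neg_sub, div_neg]
    rw [e]
    have : 0 < M / (a - b) * Real.exp ((b - a) * t) := by positivity
    linarith
  obtain ⟨b₀, hb₀, hf₀⟩ := hf
  have hC : ∃ C, Tendsto (fun t => Real.exp (-a * t) * y t) atTop (𝓝 C) := by
    obtain ⟨M, hM, T, h⟩ := key b₀ hb₀ hf₀
    apply cauchySeq_tendsto_of_complete
    rw [Metric.cauchySeq_iff']
    intro e he
    have : Tendsto (fun t => M * Real.exp ((b₀ - a) * t)) atTop (𝓝 0) := by
      simpa using (tendsto_exp_mul_atTop_zero (sub_neg.2 hb₀)).const_mul M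
    obtain ⟨N, hN1, hN2⟩ := ((this.eventually_lt_const he).and (eventually_ge_atTop T)).exists
    exact ⟨N, fun n hn => (h N hN2 n hn).trans_lt hN1⟩
  obtain ⟨C, hC⟩ := hC
  refine ⟨C, hC, fun b hb hf => ?_⟩
  obtain ⟨M, hM, T, h⟩ := key b hb hf
  refine IsBigO.of_bound M ?_
  filter_upwards [eventually_ge_atTop T] with s hs
  have h1 : |C - Real.exp (-a * s) * y s| ≤ M * Real.exp ((b - a) * s) := by
    refine le_of_tendsto ((hC.sub_const _).abs) ?_
    filter_upwards [eventually_ge_atTop s] with t ht using h s hs t ht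
  have e : y s - C * Real.exp (a * s) = -(Real.exp (a * s) * (C - Real.exp (-a * s) * y s)) := by
    linear_combination (-y s) * exp_neg_mul_mul_exp a s
  rw [e, norm_neg, norm_mul, Real.norm_eq_abs, Real.norm_eq_abs, Real.norm_eq_abs,
    abs_of_pos (Real.exp_pos _), abs_of_pos (Real.exp_pos _)]
  calc _ ≤ Real.exp (a * s) * (M * Real.exp ((b - a) * s)) := by gcongr
    _ = M * (Real.exp (a * s) * Real.exp ((b - a) * s)) := by ring
    _ = _ := by rw [← Real.exp_add]; ring_nf

/-- Solutions of `y' = a y + f` with forcing of larger exponential order than `exp (a t)`. -/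
theorem isBigO_exp_of_lt_atTop {a b : ℝ} {y f : ℝ → ℝ}
    (hy : ∀ t, HasDerivAt y (a * y t + f t) t) (hab : a < b)
    (hf : f =O[atTop] fun t => Real.exp (b * t)) :
    y =O[atTop] fun t => Real.exp (b * t) := by
  obtain ⟨M, hM, T, hT, h⟩ := exists_bound_of_isBigO_exp hf
  have hd : 0 < b - a := by linarith
  refine IsBigO.of_bound (M / (b - a) + |Real.exp (-a * T) * y T|) ?_
  filter_upwards [eventually_ge_atTop T] with t ht
  have h1 := abs_sub_le_of_deriv_bound (T := T) (fun t => hasDerivAt_exp_neg_mul (hy t))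
      (fun t => hasDerivAt_div_mul_exp (M := M) (d := b - a) hd.ne' t)
      (fun t ht => abs_exp_neg_mul_mul_le (h t ht)) le_rfl ht
  have h2 : 0 < M / (b - a) * Real.exp ((b - a) * T) := by positivity
  -- Here `T ≥ 0` matters: the value at `T` is absorbed into the growing exponential.
  have h3 : (1 : ℝ) ≤ Real.exp ((b - a) * t) :=
    Real.one_le_exp (mul_nonneg hd.le (hT.trans ht))
  have h4 : |Real.exp (-a * t) * y t| ≤
      (M / (b - a) + |Real.exp (-a * T) * y T|) * Real.exp ((b - a) * t) := by
    have := abs_sub_abs_le_abs_sub (Real.exp (-a * t) * y t) (Real.exp (-a * T) * y T)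
    nlinarith [abs_nonneg (Real.exp (-a * T) * y T)]
  have e : y t = Real.exp (a * t) * (Real.exp (-a * t) * y t) := by
    linear_combination (-y t) * exp_neg_mul_mul_exp a t
  rw [e, norm_mul, Real.norm_eq_abs, Real.norm_eq_abs, Real.norm_eq_abs,
    abs_of_pos (Real.exp_pos _), abs_of_pos (Real.exp_pos _)]
  calc _ ≤ Real.exp (a * t) * ((M / (b - a) + |Real.exp (-a * T) * y T|) *
            Real.exp ((b - a) * t)) := by gcongr
    _ = (M / (b - a) + |Real.exp (-a * T) * y T|) *
          (Real.exp (a * t) * Real.exp ((b - a) * t)) := by ring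
    _ = _ := by rw [← Real.exp_add]; ring_nf

theorem tendsto_exp_neg_mul_mul_of_isBigO_one {a : ℝ} (ha : 0 < a) {y : ℝ → ℝ}
    (hy : y =O[atTop] fun _ => (1 : ℝ)) :
    Tendsto (fun t => Real.exp (-a * t) * y t) atTop (𝓝 0) := by
  have h1 : (fun t => Real.exp (-a * t) * y t) =O[atTop] fun t => Real.exp (-a * t) * 1 :=
    (isBigO_refl _ _).mul hy
  refine h1.trans_tendsto ?_
  simpa using tendsto_exp_mul_atTop_zero (neg_neg_of_pos ha)

/-- Bounded solutions of `y' = a y + f`, where `a > 0`, inherit the exponential decay of `f`. -/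
theorem isBigO_exp_of_bounded_atTop {a b : ℝ} {y f : ℝ → ℝ}
    (hy : ∀ t, HasDerivAt y (a * y t + f t) t) (ha : 0 < a) (hb : b < a)
    (hbd : y =O[atTop] fun _ => (1 : ℝ)) (hf : f =O[atTop] fun t => Real.exp (b * t)) :
    y =O[atTop] fun t => Real.exp (b * t) := by
  obtain ⟨C, hC, h⟩ := exists_isBigO_sub_exp_atTop hy ⟨b, hb, hf⟩
  have := tendsto_nhds_unique hC (tendsto_exp_neg_mul_mul_of_isBigO_one ha hbd)
  subst this
  simpa using h b hb hf

theorem exists_isBigO_sub_exp_atBot {a : ℝ} {y f : ℝ → ℝ}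
    (hy : ∀ t, HasDerivAt y (a * y t + f t) t)
    (hf : ∃ b > a, f =O[atBot] fun t => Real.exp (b * t)) :
    ∃ C, Tendsto (fun t => Real.exp (-a * t) * y t) atBot (𝓝 C) ∧
      ∀ b > a, (f =O[atBot] fun t => Real.exp (b * t)) →
        (fun t => y t - C * Real.exp (a * t)) =O[atBot] fun t => Real.exp (b * t) := by
  have hy' : ∀ t, HasDerivAt (fun t => y (-t)) (-a * y (-t) + -f (-t)) t := by
    intro t
    refine ((hy (-t)).scomp t (hasDerivAt_neg t)).congr_deriv ?_
    rw [smul_eq_mul]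
    ring
  have hf' : ∀ b, (f =O[atBot] fun t => Real.exp (b * t)) →
      (fun t => -f (-t)) =O[atTop] fun t => Real.exp (-b * t) := by
    intro b h
    have := (h.comp_tendsto tendsto_neg_atTop_atBot).neg_left
    simpa [Function.comp_def] using this
  obtain ⟨b₀, hb₀, hf₀⟩ := hf
  obtain ⟨C, hC, h⟩ := exists_isBigO_sub_exp_atTop hy' ⟨-b₀, by linarith, hf' _ hf₀⟩
  refine ⟨C, ?_, fun b hb hf => ?_⟩
  · simpa [Function.comp_def] using hC.comp tendsto_neg_atBot_atTop
  · simpa [Function.comp_def] using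
      (h (-b) (by linarith) (hf' b hf)).comp_tendsto tendsto_neg_atBot_atTop

theorem isBigO_exp_of_lt_atBot {a b : ℝ} {y f : ℝ → ℝ}
    (hy : ∀ t, HasDerivAt y (a * y t + f t) t) (hab : b < a)
    (hf : f =O[atBot] fun t => Real.exp (b * t)) :
    y =O[atBot] fun t => Real.exp (b * t) := by
  have hy' : ∀ t, HasDerivAt (fun t => y (-t)) (-a * y (-t) + -f (-t)) t := by
    intro t
    refine ((hy (-t)).scomp t (hasDerivAt_neg t)).congr_deriv ?_
    rw [smul_eq_mul]
    ring
  have hf' : (fun t => -f (-t)) =O[atTop] fun t => Real.exp (-b * t) := by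
    have := (hf.comp_tendsto tendsto_neg_atTop_atBot).neg_left
    simpa [Function.comp_def] using this
  have := isBigO_exp_of_lt_atTop hy' (by linarith) hf'
  simpa [Function.comp_def] using this.comp_tendsto tendsto_neg_atBot_atTop

theorem monotone_of_hasDerivAt_nonneg {v v' : ℝ → ℝ} (hv : ∀ t, HasDerivAt v (v' t) t)
    (h : ∀ t, 0 ≤ v' t) : Monotone v :=
  monotone_of_deriv_nonneg (fun t => (hv t).differentiableAt) fun t => by
    rw [(hv t).deriv]; exact h t

theorem strictMono_of_hasDerivAt_pos {v v' : ℝ → ℝ} (hv : ∀ t, HasDerivAt v (v' t) t)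
    (h : ∀ t, 0 < v' t) : StrictMono v :=
  strictMono_of_deriv_pos fun t => by rw [(hv t).deriv]; exact h t

/-- A bounded solution of `p' = a p + f` with `a > 0` and `f ≥ 0` is nonpositive. -/
theorem nonpos_of_bounded_of_forcing_nonneg {a : ℝ} {p f : ℝ → ℝ}
    (hp : ∀ t, HasDerivAt p (a * p t + f t) t) (ha : 0 < a)
    (hbd : p =O[atTop] fun _ => (1 : ℝ)) (hf : ∀ t, 0 ≤ f t) (t : ℝ) : p t ≤ 0 := by
  have hm := monotone_of_hasDerivAt_nonneg (fun t => hasDerivAt_exp_neg_mul (hp t))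
    fun t => mul_nonneg (Real.exp_pos _).le (hf t)
  have h1 := hm.ge_of_tendsto (tendsto_exp_neg_mul_mul_of_isBigO_one ha hbd) t
  exact nonpos_of_mul_nonpos_right h1 (Real.exp_pos _)

/-- A bounded solution of `p' = a p + f` with `a > 0` and `f > 0` is negative. -/
theorem neg_of_bounded_of_forcing_pos {a : ℝ} {p f : ℝ → ℝ}
    (hp : ∀ t, HasDerivAt p (a * p t + f t) t) (ha : 0 < a)
    (hbd : p =O[atTop] fun _ => (1 : ℝ)) (hf : ∀ t, 0 < f t) (t : ℝ) : p t < 0 := by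
  have hm : StrictMono fun t => Real.exp (-a * t) * p t :=
    strictMono_of_hasDerivAt_pos (fun t => hasDerivAt_exp_neg_mul (hp t))
      fun t => mul_pos (Real.exp_pos _) (hf t)
  have h1 := hm.monotone.ge_of_tendsto (tendsto_exp_neg_mul_mul_of_isBigO_one ha hbd) (t + 1)
  have h2 := (hm (lt_add_one t)).trans_le h1
  exact neg_of_mul_neg_right h2 (Real.exp_pos _).le

/-! ### Renewal equations on a finite delay interval. -/

/-- Exponential bound for solutions of a renewal equation. -/
theorem renewal_isBigO {h b : ℝ} (hh : 0 ≤ h) {k f G : ℝ → ℝ} (hk : Continuous k)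
    (hk0 : ∀ r ∈ Set.Icc 0 h, 0 ≤ k r) (hf : Continuous f)
    (heq : ∀ t, f t = (∫ r in (0 : ℝ)..h, k r * f (t - r)) + G t)
    (hθ : ∫ r in (0 : ℝ)..h, k r * Real.exp (-b * r) < 1)
    (hG : G =O[atTop] fun t => Real.exp (b * t)) :
    f =O[atTop] fun t => Real.exp (b * t) := by
  set θ := ∫ r in (0 : ℝ)..h, k r * Real.exp (-b * r) with hθdef
  obtain ⟨C, hC, T, -, hGT⟩ := exists_bound_of_isBigO_exp hG
  set v : ℝ → ℝ := fun t => Real.exp (-b * t) * |f t| with hv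
  have hvc : Continuous v := by fun_prop
  have hfv : ∀ t, |f t| = Real.exp (b * t) * v t := by
    intro t
    simp only [hv]
    linear_combination (-|f t|) * exp_neg_mul_mul_exp b t
  obtain ⟨t₁, -, ht₁⟩ := (isCompact_Icc (a := T - h) (b := T)).exists_isMaxOn
    ⟨T, by constructor <;> linarith⟩ hvc.continuousOn
  have hv0 : ∀ t, 0 ≤ v t := fun t => by positivity
  have h1θ : 0 < 1 - θ := by linarith
  refine IsBigO.of_bound (v t₁ + C / (1 - θ)) ?_
  filter_upwards [eventually_ge_atTop T] with X hX
  -- At a maximizer `s > T` of `v` on `[T - h, X]` the equation gives `v s ≤ θ v s + C`, so the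
  -- bound on `v` does not depend on `X`.
  obtain ⟨s, hs, hsmax⟩ := (isCompact_Icc (a := T - h) (b := X)).exists_isMaxOn
    ⟨T, by constructor <;> linarith⟩ hvc.continuousOn
  have hsle : v s ≤ v t₁ + C / (1 - θ) := by
    rcases le_or_gt s T with h' | h'
    · have : v s ≤ v t₁ := ht₁ ⟨hs.1, h'⟩
      have : 0 ≤ C / (1 - θ) := by positivity
      linarith
    · have h2 : |f s| ≤ Real.exp (b * s) * (θ * v s) + C * Real.exp (b * s) := by
        have h3 : |∫ r in (0 : ℝ)..h, k r * f (s - r)| ≤ Real.exp (b * s) * (θ * v s) := by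
          have e : Real.exp (b * s) * (θ * v s) =
              ∫ r in (0 : ℝ)..h, k r * Real.exp (-b * r) * (Real.exp (b * s) * v s) := by
            rw [intervalIntegral.integral_mul_const, ← hθdef]; ring
          rw [e, ← Real.norm_eq_abs]
          refine intervalIntegral.norm_integral_le_of_norm_le hh ?_
            (Continuous.intervalIntegrable (by fun_prop) _ _)
          refine Eventually.of_forall fun r hr => ?_
          have hr' : r ∈ Set.Icc 0 h := ⟨hr.1.le, hr.2⟩
          have h4 : v (s - r) ≤ v s := hsmax ⟨by linarith [hr.2], by linarith [hr.1, hs.2]⟩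
          rw [norm_mul, Real.norm_eq_abs, Real.norm_eq_abs, abs_of_nonneg (hk0 r hr'), hfv,
            mul_assoc]
          have e2 : Real.exp (b * (s - r)) = Real.exp (-b * r) * Real.exp (b * s) := by
            rw [← Real.exp_add]; ring_nf
          rw [e2, mul_assoc]
          have := hk0 r hr'
          gcongr
        calc |f s| = |(∫ r in (0 : ℝ)..h, k r * f (s - r)) + G s| := by rw [← heq]
          _ ≤ _ := abs_add_le _ _
          _ ≤ _ := add_le_add h3 (hGT s h'.le)
      rw [hfv, ← mul_comm (Real.exp (b * s)) C, ← mul_add] at h2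
      have h5 := le_of_mul_le_mul_left h2 (Real.exp_pos _)
      have : v s ≤ C / (1 - θ) := by
        rw [le_div_iff₀ h1θ]; linarith
      linarith [hv0 t₁]
  have hX' : v X ≤ v s := hsmax ⟨by linarith, le_rfl⟩
  rw [Real.norm_eq_abs, Real.norm_eq_abs, abs_of_pos (Real.exp_pos _), hfv, mul_comm]
  gcongr
  exact hX'.trans hsle

/-- A bounded solution of a defective renewal equation with nonpositive forcing lies below the
forcing. -/
theorem renewal_le_neg {h : ℝ} (hh : 0 ≤ h) {k f g : ℝ → ℝ} (hk : Continuous k)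
    (hk0 : ∀ r ∈ Set.Icc 0 h, 0 ≤ k r) (hf : Continuous f) (hbd : ∃ B, ∀ t, f t ≤ B)
    (heq : ∀ t, f t = (∫ r in (0 : ℝ)..h, k r * f (t - r)) - g t)
    (hθ : ∫ r in (0 : ℝ)..h, k r < 1) (hg : ∀ t, 0 ≤ g t) (t : ℝ) : f t ≤ -g t := by
  have hB : BddAbove (Set.range f) := by
    obtain ⟨B, hB⟩ := hbd
    exact ⟨B, by rintro _ ⟨t, rfl⟩; exact hB t⟩
  have hint : ∀ t S, (∀ s, f s ≤ S) →
      ∫ r in (0 : ℝ)..h, k r * f (t - r) ≤ (∫ r in (0 : ℝ)..h, k r) * S := by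
    intro t S hS
    rw [← intervalIntegral.integral_mul_const]
    refine intervalIntegral.integral_mono_on hh (Continuous.intervalIntegrable (by fun_prop) _ _)
      (Continuous.intervalIntegrable (by fun_prop) _ _) fun r hr => ?_
    exact mul_le_mul_of_nonneg_left (hS _) (hk0 r hr)
  have hS : ∀ s, f s ≤ ⨆ s, f s := fun s => le_ciSup hB s
  -- The supremum `S` satisfies `S ≤ θ S` with `θ < 1`, which forces `S ≤ 0`.
  have hle : (⨆ s, f s) ≤ (∫ r in (0 : ℝ)..h, k r) * ⨆ s, f s :=
    ciSup_le fun s => by rw [heq]; linarith [hint s _ hS, hg s]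
  have hS0 : (⨆ s, f s) ≤ 0 := by
    by_contra hpos
    push Not at hpos
    nlinarith
  have := hint t 0 fun s => (hS s).trans hS0
  rw [heq]
  linarith

theorem hasDerivAt_integral_mul_comp_sub {h : ℝ} {k Φ F : ℝ → ℝ} (hk : Continuous k)
    (hF : Continuous F) (hΦ : ∀ t, HasDerivAt Φ (F t) t) (t : ℝ) :
    HasDerivAt (fun t => ∫ r in (0 : ℝ)..h, k r * Φ (t - r))
      (∫ r in (0 : ℝ)..h, k r * F (t - r)) t := by
  have hΦc : Continuous Φ := continuous_iff_continuousAt.2 fun t => (hΦ t).continuousAt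
  obtain ⟨M, hM⟩ := ((isCompact_closedBall t 1).prod (isCompact_uIcc (a := (0 : ℝ)) (b := h))
    |>.exists_bound_of_continuousOn (f := fun p : ℝ × ℝ => k p.2 * F (p.1 - p.2))
      (by fun_prop))
  refine (intervalIntegral.hasDerivAt_integral_of_dominated_loc_of_deriv_le
    (F := fun t r => k r * Φ (t - r)) (F' := fun t r => k r * F (t - r)) (bound := fun _ => M)
    (Metric.ball_mem_nhds t one_pos) ?_ ?_ ?_ ?_ ?_ ?_).2
  · exact Eventually.of_forall fun x =>
      (by fun_prop : Continuous fun r => k r * Φ (x - r)).aestronglyMeasurable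
  · exact Continuous.intervalIntegrable (by fun_prop) _ _
  · exact (by fun_prop : Continuous fun r => k r * F (t - r)).aestronglyMeasurable
  · refine Eventually.of_forall fun r hr x hx => ?_
    exact hM (x, r) ⟨Metric.ball_subset_closedBall hx, Set.uIoc_subset_uIcc hr⟩
  · exact intervalIntegrable_const
  · refine Eventually.of_forall fun r hr x hx => ?_
    exact ((hΦ (x - r)).comp_sub_const x r).const_mul _

/-- A quantitative renewal theorem: if the density `κ` dominates a multiple of its tail, then the
solutions converge exponentially fast. -/
theorem renewal_tendsto {h a δ : ℝ} (hh : 0 < h) (ha : 0 < a) (hδ : 0 < δ) {κ F G : ℝ → ℝ}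
    (hκ : Continuous κ) (hκ0 : ∀ r ∈ Set.Icc 0 h, 0 ≤ κ r)
    (hκ1 : ∫ r in (0 : ℝ)..h, κ r = 1)
    (hκδ : ∀ r ∈ Set.Icc 0 h, δ * ∫ s in r..h, κ s ≤ κ r)
    (hF : Continuous F) (hFbot : Tendsto F atBot (𝓝 0))
    (heq : ∀ t, F t = (∫ r in (0 : ℝ)..h, κ r * F (t - r)) - G t)
    (hG : ∀ t, 0 < G t) (hGO : G =O[atTop] fun t => Real.exp (-a * t)) :
    ∃ L < 0, ∀ᶠ σ : ℝ in 𝓝[>] 0, (fun t => F t - L) =O[atTop] fun t => Real.exp (-σ * t) := by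
  have hκi : ∀ a b, IntervalIntegrable κ MeasureTheory.volume a b :=
    fun a b => hκ.intervalIntegrable a b
  set K : ℝ → ℝ := fun r => ∫ s in r..h, κ s with hK
  have hKd : ∀ r, HasDerivAt K (-κ r) r := fun r =>
    intervalIntegral.integral_hasDerivAt_left (hκi _ _)
      hκ.stronglyMeasurable.stronglyMeasurableAtFilter hκ.continuousAt
  have hKc : Continuous K := continuous_iff_continuousAt.2 fun t => (hKd t).continuousAt
  have hKh : K h = 0 := by simp [hK]
  have hK00 : K 0 = 1 := hκ1
  have hK0 : ∀ r ∈ Set.Icc 0 h, 0 ≤ K r := fun r hr =>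
    intervalIntegral.integral_nonneg hr.2 fun s hs => hκ0 s ⟨hr.1.trans hs.1, hs.2⟩
  have hK1 : ∀ r ∈ Set.Icc 0 h, K r ≤ 1 := fun r hr => by
    have h1 : (∫ s in (0 : ℝ)..r, κ s) + K r = 1 := by
      rw [← hκ1]; exact intervalIntegral.integral_add_adjacent_intervals (hκi _ _) (hκi _ _)
    have h2 : 0 ≤ ∫ s in (0 : ℝ)..r, κ s :=
      intervalIntegral.integral_nonneg hr.1 fun s hs => hκ0 s ⟨hs.1, hs.2.trans hr.2⟩
    linarith
  set m := ∫ r in (0 : ℝ)..h, K r with hm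
  have hm0 : 0 < m :=
    intervalIntegral.integral_pos hh hKc.continuousOn (fun r hr => hK0 r ⟨hr.1.le, hr.2⟩)
      ⟨0, ⟨le_rfl, hh.le⟩, by rw [hK00]; exact one_pos⟩
  set Φ : ℝ → ℝ := fun t => ∫ s in (0 : ℝ)..t, F s
  have hΦ : ∀ t, HasDerivAt Φ (F t) t := fun t => hF.integral_hasStrictDerivAt 0 t |>.hasDerivAt
  have hΦc : Continuous Φ := continuous_iff_continuousAt.2 fun t => (hΦ t).continuousAt
  -- `J` is the conserved quantity of the unforced equation: integration by parts gives `J = Φ - κ *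
  -- Φ` (convolution), whence `J' = -G`. It vanishes at `-∞` and decreases, so its limit `C` at `+∞`
  -- is negative. A constant `F = L` has `J = m L`, which identifies `L = C / m`.
  set J : ℝ → ℝ := fun t => ∫ r in (0 : ℝ)..h, K r * F (t - r) with hJ
  have hJeq : ∀ t, J t = Φ t - ∫ r in (0 : ℝ)..h, κ r * Φ (t - r) := by
    intro t
    have := intervalIntegral.integral_mul_deriv_eq_deriv_mul (a := 0) (b := h)
      (u := K) (u' := fun r => -κ r) (v := fun r => -Φ (t - r)) (v' := fun r => F (t - r))
      (fun r _ => hKd r)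
      (fun r _ => ((hΦ (t - r)).comp_const_sub t r).neg.congr_deriv (neg_neg _))
      (hκi _ _).neg (Continuous.intervalIntegrable (by fun_prop) _ _)
    simp only [hJ, this, hKh, hK00]
    simp
  have hJd : ∀ t, HasDerivAt J (0 * J t + -G t) t := by
    intro t
    have := (hΦ t).sub (hasDerivAt_integral_mul_comp_sub (h := h) hκ hF hΦ t)
    have e : J = fun t => Φ t - ∫ r in (0 : ℝ)..h, κ r * Φ (t - r) := funext hJeq
    rw [e]
    refine this.congr_deriv ?_
    rw [heq t]; ring
  have hJbot : Tendsto J atBot (𝓝 0) := by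
    rw [Metric.tendsto_nhds]
    intro e he
    have he' : 0 < e / (2 * h) := by positivity
    obtain ⟨S, hS⟩ := eventually_atBot.1 ((Metric.tendsto_nhds.1 hFbot) _ he')
    filter_upwards [eventually_le_atBot S] with t ht
    have : ‖J t‖ ≤ e / (2 * h) * |h - 0| := by
      refine intervalIntegral.norm_integral_le_of_norm_le_const fun r hr => ?_
      rw [Set.uIoc_of_le hh.le] at hr
      have h1 := hS (t - r) (by linarith [hr.1])
      rw [dist_zero_right] at h1
      have hr' : r ∈ Set.Icc 0 h := ⟨hr.1.le, hr.2⟩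
      rw [norm_mul, Real.norm_of_nonneg (hK0 r hr')]
      nlinarith [hK0 r hr', hK1 r hr', norm_nonneg (F (t - r))]
    rw [dist_zero_right]
    refine this.trans_lt ?_
    rw [sub_zero, abs_of_pos hh]
    field_simp
    norm_num
  have hJanti : StrictAnti J := strictAnti_of_deriv_neg fun t => by
    rw [(hJd t).deriv]; linarith [hG t]
  obtain ⟨C, hC, hCO⟩ := exists_isBigO_sub_exp_atTop hJd ⟨-a, by linarith, hGO.neg_left⟩
  have hC' : Tendsto J atTop (𝓝 C) := by simpa using hC
  have hC0 : C < 0 := by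
    have h1 : C ≤ J 1 := hJanti.antitone.le_of_tendsto hC' 1
    have h2 : J 0 ≤ 0 := hJanti.antitone.ge_of_tendsto hJbot 0
    linarith [hJanti (zero_lt_one (α := ℝ))]
  refine ⟨C / m, div_neg_of_neg_of_pos hC0 hm0, ?_⟩
  have hsmall : ∀ᶠ σ : ℝ in 𝓝[>] 0, Real.exp (σ * h) * (1 - δ * m) < 1 := by
    have : Tendsto (fun σ : ℝ => Real.exp (σ * h) * (1 - δ * m)) (𝓝[>] 0)
        (𝓝 (Real.exp (0 * h) * (1 - δ * m))) :=
      (Continuous.tendsto (by fun_prop) 0).mono_left nhdsWithin_le_nhds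
    refine this.eventually_lt_const ?_
    simp only [zero_mul, Real.exp_zero, one_mul]
    linarith [mul_pos hδ hm0]
  filter_upwards [hsmall, Ioo_mem_nhdsGT ha] with σ hσ hσa
  have hGσ : G =O[atTop] fun t => Real.exp (-σ * t) :=
    hGO.trans (isBigO_exp_atTop (by linarith [hσa.2]))
  have hJσ : (fun t => J t - C) =O[atTop] fun t => Real.exp (-σ * t) := by
    have := hCO (-σ) (by linarith [hσa.1]) hGσ.neg_left
    simpa using this
  -- Adding and subtracting `δ J` turns the equation for `F - L` into one with kernel `κ - δ K`,
  -- still nonnegative but of mass `1 - δ m < 1`. The new forcing `δ (J - C) - G` decays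
  -- exponentially, so `renewal_isBigO` applies.
  refine renewal_isBigO hh.le (k := fun r => κ r - δ * K r) (G := fun t => δ * (J t - C) - G t)
    (by fun_prop) (fun r hr => sub_nonneg.2 (hκδ r hr)) (by fun_prop) ?_ ?_
    ((hJσ.const_mul_left δ).sub hGσ)
  · intro t
    have i1 : IntervalIntegrable (fun r => κ r * F (t - r)) MeasureTheory.volume 0 h :=
      Continuous.intervalIntegrable (by fun_prop) _ _
    have i2 : IntervalIntegrable (fun r => δ * (K r * F (t - r))) MeasureTheory.volume 0 h :=
      Continuous.intervalIntegrable (by fun_prop) _ _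
    have i3 : IntervalIntegrable (fun r => κ r * (C / m)) MeasureTheory.volume 0 h :=
      Continuous.intervalIntegrable (by fun_prop) _ _
    have i4 : IntervalIntegrable (fun r => δ * (K r * (C / m))) MeasureTheory.volume 0 h :=
      Continuous.intervalIntegrable (by fun_prop) _ _
    have : (∫ r in (0 : ℝ)..h, (κ r - δ * K r) * (F (t - r) - C / m)) =
        (∫ r in (0 : ℝ)..h, κ r * F (t - r)) - δ * J t - C / m + δ * (m * (C / m)) := by
      calc _ = ∫ r in (0 : ℝ)..h, (κ r * F (t - r) - δ * (K r * F (t - r)) - κ r * (C / m)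
              + δ * (K r * (C / m))) := by
            congr 1; ext r; ring
        _ = _ := by
          rw [intervalIntegral.integral_add ((i1.sub i2).sub i3) i4,
            intervalIntegral.integral_sub (i1.sub i2) i3, intervalIntegral.integral_sub i1 i2,
            intervalIntegral.integral_const_mul, intervalIntegral.integral_const_mul,
            intervalIntegral.integral_mul_const, intervalIntegral.integral_mul_const, hκ1, ← hm]
          ring
    rw [this, mul_div_cancel₀ _ hm0.ne', heq t]
    ring
  · have e : ∫ r in (0 : ℝ)..h, (κ r - δ * K r) * Real.exp (σ * h) =
        Real.exp (σ * h) * (1 - δ * m) := by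
      rw [intervalIntegral.integral_mul_const, intervalIntegral.integral_sub (hκi _ _)
        (Continuous.intervalIntegrable (by fun_prop) _ _), intervalIntegral.integral_const_mul,
        hκ1, mul_comm]
    refine lt_of_le_of_lt ?_ (e.trans_lt hσ)
    refine intervalIntegral.integral_mono_on hh.le
      (Continuous.intervalIntegrable (by fun_prop) _ _)
      (Continuous.intervalIntegrable (by fun_prop) _ _) fun r hr => ?_
    refine mul_le_mul_of_nonneg_left (Real.exp_le_exp.2 ?_) (sub_nonneg.2 (hκδ r hr))
    rw [neg_neg]
    exact mul_le_mul_of_nonneg_left hr.2 hσa.1.le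

/-! ### Factorization of the characteristic function. -/

/-- The kernel of the renewal equation obtained by dividing the characteristic function by
`(z - a) (z - b)`, where `a` and `b` are two of its zeros. -/
noncomputable def kernel (h a b r : ℝ) : ℝ :=
  (Real.exp (-(a * (h - r))) - Real.exp (-(b * (h - r)))) / (b - a)

/-- The quotient of the characteristic function by `(z - a) (z - b)`. -/
noncomputable def quot (h ε a b z : ℝ) : ℝ :=
  ε - ∫ r in (0 : ℝ)..h, kernel h a b r * Real.exp (-z * r)

@[fun_prop]
theorem continuous_kernel (h a b : ℝ) : Continuous (kernel h a b) := by
  unfold kernel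
  fun_prop

theorem continuous_psi (h ε : ℝ) : Continuous (psi h ε) := by
  unfold psi
  fun_prop

theorem psi_zero (h ε : ℝ) : psi h ε 0 = -1 := by simp [psi]

theorem psi_add (h ε d z : ℝ) : psi h (ε + d) z = psi h ε z + d * z ^ 2 := by
  unfold psi
  ring

section
variable {h ε a b : ℝ}

theorem kernel_nonneg (hab : a < b) {r : ℝ} (hr : r ≤ h) : 0 ≤ kernel h a b r := by
  unfold kernel
  refine div_nonneg (sub_nonneg.2 (Real.exp_le_exp.2 ?_)) (by linarith)
  nlinarith

theorem kernel_pos (hab : a < b) {r : ℝ} (hr : r < h) : 0 < kernel h a b r := by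
  unfold kernel
  refine div_pos (sub_pos.2 (Real.exp_lt_exp.2 ?_)) (by linarith)
  nlinarith

/-- Later values of the kernel are controlled by earlier ones. This makes the kernel dominate a
multiple of its own tail, as `renewal_tendsto` requires. -/
theorem kernel_le (hab : a < b) {r s : ℝ} (hrs : r ≤ s) :
    kernel h a b s ≤ Real.exp (b * (s - r)) * kernel h a b r := by
  have hd : 0 < b - a := by linarith
  unfold kernel
  rw [← mul_div_assoc]
  refine div_le_div_of_nonneg_right ?_ hd.le
  rw [mul_sub (Real.exp _), ← Real.exp_add, ← Real.exp_add]
  have e : b * (s - r) + -(b * (h - r)) = -(b * (h - s)) := by ring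
  rw [e]
  refine sub_le_sub_right (Real.exp_le_exp.2 ?_) _
  nlinarith

/-- The renewal equation satisfied by `f = (D - a) (D - b) y`. -/
theorem integral_kernel_mul (hab : a < b) (ha : psi h ε a = 0) (hb : psi h ε b = 0)
    {y y₁ y₂ : ℝ → ℝ} (hy : ∀ t, HasDerivAt y (y₁ t) t) (hy₁ : ∀ t, HasDerivAt y₁ (y₂ t) t)
    (hy₂ : Continuous y₂) (t : ℝ) :
    ∫ r in (0 : ℝ)..h, kernel h a b r *
        (y₂ (t - r) - (a + b) * y₁ (t - r) + a * b * y (t - r)) =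
      ε * (y₂ t - (a + b) * y₁ t + a * b * y t) - (ε * y₂ t - y₁ t - y (t - h)) := by
  have hyc : Continuous y := continuous_iff_continuousAt.2 fun t => (hy t).continuousAt
  have hy₁c : Continuous y₁ := continuous_iff_continuousAt.2 fun t => (hy₁ t).continuousAt
  have hd : b - a ≠ 0 := by linarith
  have hexp : ∀ z r, HasDerivAt (fun r => Real.exp (-(z * (h - r))))
      (z * Real.exp (-(z * (h - r)))) r := by
    intro z r
    have := ((((hasDerivAt_id r).const_sub h).const_mul z).neg).exp
    simpa [mul_comm] using this
  have hk : ∀ r, HasDerivAt (kernel h a b)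
      ((a * Real.exp (-(a * (h - r))) - b * Real.exp (-(b * (h - r)))) / (b - a)) r :=
    fun r => ((hexp a r).sub (hexp b r)).div_const _
  have hys : ∀ r, HasDerivAt (fun r => y (t - r)) (-y₁ (t - r)) r :=
    fun r => (hy (t - r)).comp_const_sub t r
  have hy₁s : ∀ r, HasDerivAt (fun r => y₁ (t - r)) (-y₂ (t - r)) r :=
    fun r => (hy₁ (t - r)).comp_const_sub t r
  -- The integrand has an explicit primitive. At `r = h` the kernel vanishes and `y (t - h)`
  -- remains; at `r = 0` the two equations `psi = 0` turn the exponentials into polynomials in `a`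
  -- and `b`.
  have hderiv : ∀ r ∈ Set.uIcc 0 h, HasDerivAt
      (fun r => Real.exp (-(a * (h - r))) * y (t - r)
        - kernel h a b r * (y₁ (t - r) - a * y (t - r)))
      (kernel h a b r * (y₂ (t - r) - (a + b) * y₁ (t - r) + a * b * y (t - r))) r := by
    intro r _
    refine (((hexp a r).mul (hys r)).sub ((hk r).mul ((hy₁s r).sub ((hys r).const_mul a))))
      |>.congr_deriv ?_
    simp only [kernel, Pi.sub_apply]
    field_simp
    ring
  rw [intervalIntegral.integral_eq_sub_of_hasDerivAt hderiv
    (Continuous.intervalIntegrable (by fun_prop) _ _)]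
  have ha' : Real.exp (-(a * h)) = ε * a ^ 2 - a := by unfold psi at ha; linarith
  have hb' : Real.exp (-(b * h)) = ε * b ^ 2 - b := by unfold psi at hb; linarith
  simp only [kernel, sub_zero, sub_self, mul_zero, neg_zero, Real.exp_zero, ha', hb']
  field_simp
  ring

/-- This is `integral_kernel_mul` for `y = exp (z t)` at time `0`. -/
theorem quot_mul (hab : a < b) (ha : psi h ε a = 0) (hb : psi h ε b = 0) (z : ℝ) :
    quot h ε a b z * ((z - a) * (z - b)) = psi h ε z := by
  have := integral_kernel_mul hab ha hb (hasDerivAt_exp_mul z)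
    (fun t => (hasDerivAt_exp_mul z t).const_mul z) (by fun_prop) 0
  have e : ∀ r : ℝ, kernel h a b r * (z * (z * Real.exp (z * (0 - r)))
      - (a + b) * (z * Real.exp (z * (0 - r))) + a * b * Real.exp (z * (0 - r))) =
      kernel h a b r * Real.exp (-z * r) * ((z - a) * (z - b)) := by
    intro r
    rw [show z * (0 - r) = -z * r by ring]
    ring
  simp only [e] at this
  rw [intervalIntegral.integral_mul_const] at this
  unfold quot psi
  rw [sub_mul, this]
  simp
  ring

/-- The hypothesis `ha'` says that the `z`-derivative of `psi` vanishes at `a`, so `t exp (a t)`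
solves the linear equation. Inserting it in `integral_kernel_mul`, with `(D - a)(D - b)` sending it
to `(a - b) exp (a t)`, gives the claim. -/
theorem quot_eq_zero_of_double (hab : a < b) (ha : psi h ε a = 0) (hb : psi h ε b = 0)
    (ha' : 2 * ε * a - 1 + h * Real.exp (-(a * h)) = 0) : quot h ε a b a = 0 := by
  have hy : ∀ t, HasDerivAt (fun t => t * Real.exp (a * t)) ((1 + a * t) * Real.exp (a * t)) t := by
    intro t
    refine ((hasDerivAt_id t).mul (hasDerivAt_exp_mul a t)).congr_deriv ?_
    simp only [id]
    ring
  have hy₁ : ∀ t, HasDerivAt (fun t => (1 + a * t) * Real.exp (a * t))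
      ((2 * a + a ^ 2 * t) * Real.exp (a * t)) t := by
    intro t
    refine ((((hasDerivAt_id t).const_mul a).const_add 1).mul
      (hasDerivAt_exp_mul a t)).congr_deriv ?_
    simp only [id]
    ring
  have := integral_kernel_mul hab ha hb hy hy₁ (by fun_prop) 0
  have e : ∀ r : ℝ, kernel h a b r * ((2 * a + a ^ 2 * (0 - r)) * Real.exp (a * (0 - r))
      - (a + b) * ((1 + a * (0 - r)) * Real.exp (a * (0 - r)))
      + a * b * ((0 - r) * Real.exp (a * (0 - r)))) =
      kernel h a b r * Real.exp (-a * r) * (a - b) := by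
    intro r
    rw [show a * (0 - r) = -a * r by ring]
    ring
  simp only [e] at this
  rw [intervalIntegral.integral_mul_const] at this
  unfold quot
  have hd : a - b ≠ 0 := by linarith
  refine mul_right_cancel₀ hd ?_
  rw [sub_mul, this]
  rw [show a * (0 - h) = -(a * h) by ring]
  simp
  linarith

/-- All counting and ordering of the negative zeros below rests on this monotonicity: once `a` and
`b` are divided out, at most one real zero is left. -/
theorem quot_strictMono (hh : 0 < h) (hab : a < b) : StrictMono (quot h ε a b) := by
  intro z w hzw
  refine sub_lt_sub_left (intervalIntegral.integral_lt_integral_of_continuousOn_of_le_of_exists_lt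
    hh (by fun_prop) (by fun_prop) (fun r hr => ?_) ⟨h / 2, ⟨by linarith, by linarith⟩, ?_⟩) _
  · refine mul_le_mul_of_nonneg_left (Real.exp_le_exp.2 ?_) (kernel_nonneg hab hr.2)
    nlinarith [hr.1]
  · refine mul_lt_mul_of_pos_left (Real.exp_lt_exp.2 ?_) (kernel_pos hab (by linarith))
    nlinarith

/-- Without delay the quotient is the constant `ε`, so strict monotonicity is lost but positivity
remains; both situations are needed later. -/
theorem quot_pos_of_lt (hh : 0 ≤ h) (hε : 0 < ε) (hab : a < b) {z w : ℝ} (hz : 0 ≤ quot h ε a b z)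
    (hzw : z < w) : 0 < quot h ε a b w := by
  rcases hh.eq_or_lt with rfl | hh
  · simpa [quot] using hε
  · exact hz.trans_lt (quot_strictMono hh hab hzw)

/-! ### Real zeros of the characteristic function. -/

theorem exists_pos_zero (hh : 0 ≤ h) (hε : 0 < ε) : ∃ z > 0, psi h ε z = 0 := by
  -- At this point `ε z² - z = 2/ε + 3 + ε`, which exceeds the bound `1` for the exponential.
  have h1 : 0 ≤ psi h ε (2 / ε + 1) := by
    unfold psi
    have : Real.exp (-((2 / ε + 1) * h)) ≤ 1 := by
      rw [Real.exp_le_one_iff]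
      have : 0 ≤ (2 / ε + 1) * h := by positivity
      linarith
    have e : ε * (2 / ε + 1) ^ 2 - (2 / ε + 1) = 2 / ε + 3 + ε := by field_simp; ring
    have : 0 < 2 / ε := by positivity
    rw [e]
    linarith
  have h2 : (0 : ℝ) ≤ 2 / ε + 1 := by positivity
  obtain ⟨z, hz, hz0⟩ := intermediate_value_Icc h2 (continuous_psi h ε).continuousOn
    ⟨by rw [psi_zero]; norm_num, h1⟩
  refine ⟨z, lt_of_le_of_ne hz.1 fun e => ?_, hz0⟩
  rw [← e, psi_zero] at hz0
  norm_num at hz0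

theorem exists_zero_ge {z : ℝ} (hz : z < 0) (hp : 0 ≤ psi h ε z) :
    ∃ w, z ≤ w ∧ w < 0 ∧ psi h ε w = 0 := by
  obtain ⟨w, hw, hw0⟩ := intermediate_value_Icc' hz.le (continuous_psi h ε).continuousOn
    ⟨by rw [psi_zero]; norm_num, hp⟩
  refine ⟨w, hw.1, lt_of_le_of_ne hw.2 fun e => ?_, hw0⟩
  rw [e, psi_zero] at hw0
  norm_num at hw0

/-- For `h > 0` the exponential outgrows the quadratic part as `z → -∞`, so `psi` becomes
nonpositive far to the left. The substitution is `z = -x / h`. -/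
theorem exists_zero_lt (hh : 0 < h) {z : ℝ} (hp : 0 < psi h ε z) :
    ∃ w < z, psi h ε w = 0 := by
  have hlim : Tendsto (fun x : ℝ => (ε / h ^ 2 + 1 / h) * (x ^ 2 * Real.exp (-x))) atTop
      (𝓝 0) := by
    simpa using (Real.tendsto_pow_mul_exp_neg_atTop_nhds_zero 2).const_mul (ε / h ^ 2 + 1 / h)
  obtain ⟨x, hx1, hx2⟩ := ((hlim.eventually_lt_const one_pos).and
    (eventually_gt_atTop (max 1 (-z * h)))).exists
  have hx1' : (ε / h ^ 2 + 1 / h) * x ^ 2 < Real.exp x := by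
    have := mul_lt_mul_of_pos_right hx1 (Real.exp_pos x)
    have e : Real.exp (-x) * Real.exp x = 1 := by rw [← Real.exp_add]; simp
    calc _ = (ε / h ^ 2 + 1 / h) * x ^ 2 * (Real.exp (-x) * Real.exp x) := by rw [e, mul_one]
      _ = (ε / h ^ 2 + 1 / h) * (x ^ 2 * Real.exp (-x)) * Real.exp x := by ring
      _ < _ := by linarith
  have hx3 : 1 < x := (le_max_left _ _).trans_lt hx2
  have hx4 : -z * h < x := (le_max_right _ _).trans_lt hx2
  have hlt : -x / h < z := by
    rw [div_lt_iff₀ hh]; linarith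
  have hneg : psi h ε (-x / h) ≤ 0 := by
    unfold psi
    have e1 : -(-x / h * h) = x := by field_simp
    have e2 : ε * (-x / h) ^ 2 - -x / h = ε / h ^ 2 * x ^ 2 + 1 / h * x := by field_simp; ring
    rw [e1, e2]
    have : 1 / h * x ≤ 1 / h * x ^ 2 := by
      refine mul_le_mul_of_nonneg_left ?_ (by positivity)
      nlinarith
    linarith
  obtain ⟨w, hw, hw0⟩ := intermediate_value_Icc hlt.le (continuous_psi h ε).continuousOn
    ⟨hneg, hp.le⟩
  refine ⟨w, lt_of_le_of_ne hw.2 fun e => ?_, hw0⟩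
  rw [e] at hw0
  exact hp.ne' hw0

/-- After division by `(z - z₂)(z - b)`, both `z₁` and any further negative zero are zeros of an
injective function. -/
theorem eq_or_eq_of_zeros (hh : 0 < h) (hε : 0 < ε) {z₁ z₂ z : ℝ} (h12 : z₁ < z₂) (h2 : z₂ < 0)
    (hz₁ : psi h ε z₁ = 0) (hz₂ : psi h ε z₂ = 0) (hz : z < 0) (hz0 : psi h ε z = 0) :
    z = z₁ ∨ z = z₂ := by
  obtain ⟨b, hb, hb0⟩ := exists_pos_zero hh.le hε
  have hab : z₂ < b := h2.trans hb
  by_contra! hne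
  have e1 := quot_mul hab hz₂ hb0 z₁
  have e2 := quot_mul hab hz₂ hb0 z
  rw [hz₁, mul_eq_zero, mul_eq_zero, sub_eq_zero, sub_eq_zero] at e1
  rw [hz0, mul_eq_zero, mul_eq_zero, sub_eq_zero, sub_eq_zero] at e2
  have e1 := e1.resolve_right (by rintro (h | h) <;> linarith)
  have e2 := e2.resolve_right (by
    rintro (h | h)
    · exact hne.2 h
    · linarith)
  exact hne.1 ((quot_strictMono hh hab).injective (e2.trans e1.symm))

theorem mem_Ioo_of_psi_pos (hh : 0 < h) (hε : 0 < ε) {z₁ z₂ z : ℝ} (h12 : z₁ < z₂) (h2 : z₂ < 0)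
    (hz₁ : psi h ε z₁ = 0) (hz₂ : psi h ε z₂ = 0) (hz : z < 0) (hz0 : 0 < psi h ε z) :
    z₁ < z ∧ z < z₂ := by
  obtain ⟨b, hb, hb0⟩ := exists_pos_zero hh.le hε
  have hab : z₂ < b := h2.trans hb
  have e1 := quot_mul hab hz₂ hb0 z₁
  have e2 := quot_mul hab hz₂ hb0 z
  rw [hz₁, mul_eq_zero, mul_eq_zero, sub_eq_zero, sub_eq_zero] at e1
  have e1 := e1.resolve_right (by rintro (h | h) <;> linarith)
  have hmono := quot_strictMono (ε := ε) hh hab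
  rw [← e2] at hz0
  constructor
  · by_contra! hle
    have hq : quot h ε z₂ b z ≤ 0 := e1 ▸ hmono.monotone hle
    have : 0 < (z - z₂) * (z - b) := mul_pos_of_neg_of_neg (by linarith) (by linarith)
    nlinarith
  · by_contra! hle
    have hq : 0 < quot h ε z₂ b z := e1 ▸ hmono (h12.trans_le hle)
    have : (z - z₂) * (z - b) ≤ 0 :=
      mul_nonpos_of_nonneg_of_nonpos (by linarith) (by linarith)
    nlinarith

/-- The quotient by `(z - z₀)(z - b)` already vanishes at `z₀`, hence nowhere else. -/
theorem eq_of_double_zero (hh : 0 < h) (hε : 0 < ε) {z₀ z : ℝ} (h0 : z₀ < 0)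
    (hz₀ : psi h ε z₀ = 0) (hz₀' : 2 * ε * z₀ - 1 + h * Real.exp (-(z₀ * h)) = 0)
    (hz : z < 0) (hz0 : psi h ε z = 0) : z = z₀ := by
  obtain ⟨b, hb, hb0⟩ := exists_pos_zero hh.le hε
  have hab : z₀ < b := h0.trans hb
  by_contra! hne
  have e1 := quot_eq_zero_of_double hab hz₀ hb0 hz₀'
  have e2 := quot_mul hab hz₀ hb0 z
  rw [hz0, mul_eq_zero, mul_eq_zero, sub_eq_zero, sub_eq_zero] at e2
  have e2 := e2.resolve_right (by
    rintro (h | h)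
    · exact hne h
    · linarith)
  exact hne ((quot_strictMono hh hab).injective (e2.trans e1.symm))

end

section
variable {h c : ℝ}

theorem lam2_mem (hne : (negZeros h c).Nonempty) : lam2 h c ∈ negZeros h c := by
  -- Since `psi` is `-1` at `0`, the strict inequality may be relaxed; the set is then closed and
  -- its supremum is attained.
  have e : negZeros h c = {z | z ≤ 0 ∧ psi h (eps c) z = 0} := by
    ext z
    refine ⟨fun hz => ⟨hz.1.le, hz.2⟩, fun hz => ⟨lt_of_le_of_ne hz.1 ?_, hz.2⟩⟩
    rintro rfl
    have := hz.2
    rw [psi_zero] at this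
    norm_num at this
  have hcl : IsClosed (negZeros h c) := by
    rw [e]
    exact isClosed_Iic.inter (isClosed_eq (continuous_psi _ _) continuous_const)
  exact hcl.csSup_mem hne ⟨0, fun z hz => hz.1.le⟩

theorem le_lam2 {z : ℝ} (hz : z < 0) (hp : 0 ≤ psi h (eps c) z) : z ≤ lam2 h c := by
  obtain ⟨w, hzw, hw, hw0⟩ := exists_zero_ge hz hp
  exact hzw.trans (le_csSup ⟨0, fun z hz => hz.1.le⟩ ⟨hw, hw0⟩)

theorem negZeros_nonempty {z : ℝ} (hz : z < 0) (hp : 0 ≤ psi h (eps c) z) :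
    (negZeros h c).Nonempty := by
  obtain ⟨w, -, hw, hw0⟩ := exists_zero_ge hz hp
  exact ⟨w, hw, hw0⟩

theorem lam1_lam2_eq (hh : 0 < h) (hε : 0 < eps c) {z₁ z₂ : ℝ} (h12 : z₁ < z₂) (h2 : z₂ < 0)
    (hz₁ : psi h (eps c) z₁ = 0) (hz₂ : psi h (eps c) z₂ = 0) :
    lam1 h c = z₁ ∧ lam2 h c = z₂ := by
  have e : negZeros h c = {z₁, z₂} := by
    ext z
    refine ⟨fun hz => eq_or_eq_of_zeros hh hε h12 h2 hz₁ hz₂ hz.1 hz.2, ?_⟩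
    rintro (rfl | rfl)
    · exact ⟨h12.trans h2, hz₁⟩
    · exact ⟨h2, hz₂⟩
  unfold lam1 lam2
  rw [e, csInf_pair, csSup_pair]
  exact ⟨min_eq_left h12.le, max_eq_right h12.le⟩

theorem lam2_eq_of_double_zero (hh : 0 < h) (hε : 0 < eps c) {z₀ : ℝ} (h0 : z₀ < 0)
    (hz₀ : psi h (eps c) z₀ = 0)
    (hz₀' : 2 * eps c * z₀ - 1 + h * Real.exp (-(z₀ * h)) = 0) : lam2 h c = z₀ := by
  have hm := lam2_mem (h := h) (c := c) ⟨z₀, h0, hz₀⟩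
  exact eq_of_double_zero hh hε h0 hz₀ hz₀' hm.1 hm.2

end

/-! ### The profile equation and a priori bounds. -/

/-- `w` is a monotone heteroclinic solution, with derivatives `w₁` and `w₂`, of the rescaled
profile equation `ε w'' - w' + w (1 - w(· - h)) = 0`. -/
structure IsProfile (h ε : ℝ) (w w₁ w₂ : ℝ → ℝ) : Prop where
  hasDerivAt : ∀ t, HasDerivAt w (w₁ t) t
  hasDerivAt₁ : ∀ t, HasDerivAt w₁ (w₂ t) t
  continuous₂ : Continuous w₂
  equation : ∀ t, ε * w₂ t - w₁ t + w t * (1 - w (t - h)) = 0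
  pos : ∀ t, 0 < w t
  monotone : Monotone w
  tendsto_atBot : Tendsto w atBot (𝓝 0)
  tendsto_atTop : Tendsto w atTop (𝓝 1)

theorem laplacian_comp_inner {m : ℕ} {ν : Space m} (hν : ‖ν‖ = 1) {g : ℝ → ℝ}
    (hg : ContDiff ℝ 2 g) (x : Space m) :
    Laplacian.laplacian (fun x => g (inner ℝ ν x)) x = iteratedDeriv 2 g (inner ℝ ν x) := by
  rw [InnerProductSpace.laplacian_eq_iteratedFDeriv_stdOrthonormalBasis]
  have hcomp : (fun x : Space m => g (inner ℝ ν x)) = g ∘ (innerSL ℝ ν) := by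
    ext x; simp
  have hterm : ∀ v : Space m, iteratedFDeriv ℝ 2 (fun x : Space m => g (inner ℝ ν x)) x ![v, v]
      = (inner ℝ ν v) ^ 2 * iteratedDeriv 2 g (inner ℝ ν x) := by
    intro v
    rw [hcomp, ContinuousLinearMap.iteratedFDeriv_comp_right _ hg _ (by norm_num)]
    rw [ContinuousMultilinearMap.compContinuousLinearMap_apply,
      iteratedFDeriv_apply_eq_iteratedDeriv_mul_prod]
    simp [Fin.prod_univ_two, pow_two]
  simp only [hterm]
  rw [← Finset.sum_mul]
  have := (stdOrthonormalBasis ℝ (Space m)).sum_sq_norm_inner_left ν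
  simp only [Real.norm_eq_abs, sq_abs] at this
  rw [this, hν]
  simp

theorem IsPositiveMonotoneFront.isProfile {m : ℕ} {h c : ℝ} {ν : Space m} {φ : ℝ → ℝ}
    (hφ : IsPositiveMonotoneFront h c ν φ) (hc : 0 < c) :
    IsProfile h (eps c) (fun t => φ (c * t)) (fun t => c * deriv φ (c * t))
      (fun t => c ^ 2 * deriv (deriv φ) (c * t)) := by
  have hνν : inner ℝ ν ν = (1 : ℝ) := by
    rw [real_inner_self_eq_norm_sq, hφ.norm_direction]; norm_num
  -- Regularity of `φ` is read off by restricting `u(0, ·)` to the line spanned by `ν`.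
  have hC : ContDiff ℝ 2 φ := by
    have h1 : ContDiff ℝ 2 fun s : ℝ => φ (inner ℝ ν (s • ν) + c * 0) :=
      (hφ.solution.contDiff_space 0).comp (contDiff_id.smul contDiff_const)
    simpa [inner_smul_right, hνν, hφ.norm_direction] using h1
  have hC1 : ContDiff ℝ 1 (deriv φ) := by
    have : ContDiff ℝ (1 + 1) φ := by simpa [one_add_one_eq_two] using hC
    exact (contDiff_succ_iff_deriv.1 this).2.2
  have hd : ∀ s, HasDerivAt φ (deriv φ s) s := fun s =>
    (hC.differentiable (by norm_num) s).hasDerivAt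
  have hd1 : ∀ s, HasDerivAt (deriv φ) (deriv (deriv φ) s) s := fun s =>
    (hC1.differentiable (by norm_num) s).hasDerivAt
  have hlin : ∀ t, HasDerivAt (fun t => c * t) c t := fun t => by
    simpa using (hasDerivAt_id t).const_mul c
  refine ⟨fun t => ?_, fun t => ?_, ?_, fun t => ?_, fun t => hφ.pos _,
    fun s t hst => hφ.monotone (mul_le_mul_of_nonneg_left hst hc.le),
    hφ.tendsto_atBot.comp (tendsto_id.const_mul_atBot hc),
    hφ.tendsto_atTop.comp (tendsto_id.const_mul_atTop hc)⟩
  · refine ((hd (c * t)).comp t (hlin t)).congr_deriv ?_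
    ring
  · refine (((hd1 (c * t)).comp t (hlin t)).const_mul c).congr_deriv ?_
    ring
  · have : Continuous (deriv (deriv φ)) := hC1.continuous_deriv (by norm_num)
    fun_prop
  · have heq := hφ.solution.equation t 0
    have e1 : deriv (fun s => φ (inner ℝ ν (0 : Space m) + c * s)) t = c * deriv φ (c * t) := by
      simp only [inner_zero_right, zero_add]
      exact ((hd (c * t)).comp t (hlin t)).deriv.trans (mul_comm _ _)
    have hgc : ContDiff ℝ 2 fun s => φ (s + c * t) := hC.comp (contDiff_id.add contDiff_const)
    have e2 := laplacian_comp_inner hφ.norm_direction hgc 0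
    have e3 : iteratedDeriv 2 (fun s => φ (s + c * t)) (inner ℝ ν (0 : Space m)) =
        deriv (deriv φ) (c * t) := by
      rw [iteratedDeriv_comp_add_const, iteratedDeriv_succ, iteratedDeriv_one]
      simp
    rw [e1, e2, e3] at heq
    simp only [inner_zero_right, zero_add] at heq
    unfold eps
    rw [heq]
    field_simp
    ring

namespace IsProfile
variable {h ε : ℝ} {w w₁ w₂ : ℝ → ℝ}

theorem le_one (hw : IsProfile h ε w w₁ w₂) (t : ℝ) : w t ≤ 1 :=
  hw.monotone.ge_of_tendsto hw.tendsto_atTop t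

theorem continuous (hw : IsProfile h ε w w₁ w₂) : Continuous w :=
  continuous_iff_continuousAt.2 fun t => (hw.hasDerivAt t).continuousAt

theorem continuous₁ (hw : IsProfile h ε w w₁ w₂) : Continuous w₁ :=
  continuous_iff_continuousAt.2 fun t => (hw.hasDerivAt₁ t).continuousAt

theorem deriv_nonneg (hw : IsProfile h ε w w₁ w₂) (t : ℝ) : 0 ≤ w₁ t := by
  rw [← (hw.hasDerivAt t).deriv]
  exact hw.monotone.deriv_nonneg

/-- By the equation `w' - w / ε` is nonincreasing. It is compared with a point of `(t - 1, t)` where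
`w'` equals the increment of `w`, which is at most `1`. -/
theorem deriv_le (hw : IsProfile h ε w w₁ w₂) (hε : 0 < ε) (t : ℝ) : w₁ t ≤ 1 / ε + 1 := by
  have hanti : Antitone fun t => w₁ t - w t / ε := by
    have hd : ∀ t, HasDerivAt (fun t => w₁ t - w t / ε) (w₂ t - w₁ t / ε) t := fun t =>
      (hw.hasDerivAt₁ t).sub ((hw.hasDerivAt t).div_const ε)
    refine antitone_of_deriv_nonpos (fun t => (hd t).differentiableAt) fun t => ?_
    rw [(hd t).deriv]
    have : w₂ t - w₁ t / ε = -(w t * (1 - w (t - h))) / ε := by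
      field_simp
      linarith [hw.equation t]
    rw [this]
    exact div_nonpos_of_nonpos_of_nonneg (neg_nonpos.2 (mul_nonneg (hw.pos t).le
      (sub_nonneg.2 (hw.le_one _)))) hε.le
  obtain ⟨ξ, hξ, hξ'⟩ := exists_hasDerivAt_eq_slope w w₁ (sub_one_lt t)
    hw.continuous.continuousOn fun x _ => hw.hasDerivAt x
  have h1 := hanti hξ.2.le
  simp only at h1
  have h2 : w₁ ξ = w t - w (t - 1) := by rw [hξ']; simp
  have h3 : w t / ε ≤ 1 / ε := div_le_div_of_nonneg_right (hw.le_one t) hε.le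
  have h4 : 0 ≤ w ξ / ε := div_nonneg (hw.pos ξ).le hε.le
  linarith [hw.le_one t, hw.pos (t - 1)]

theorem abs_second_le (hw : IsProfile h ε w w₁ w₂) (hε : 0 < ε) (t : ℝ) :
    |w₂ t| ≤ (1 / ε + 2) / ε := by
  have h1 := hw.equation t
  have h2 : w t * (1 - w (t - h)) ≤ 1 := by
    nlinarith [hw.pos t, hw.le_one t, hw.pos (t - h), hw.le_one (t - h)]
  have h3 : 0 ≤ w t * (1 - w (t - h)) := mul_nonneg (hw.pos t).le (sub_nonneg.2 (hw.le_one _))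
  rw [le_div_iff₀ hε, ← abs_of_pos hε, ← abs_mul, abs_of_pos hε, abs_le]
  constructor <;> linarith [hw.deriv_nonneg t, hw.deriv_le hε t]

end IsProfile

theorem isBigO_comp_add_exp {l : Filter ℝ} {t₀ b : ℝ} {f : ℝ → ℝ}
    (hl : Tendsto (fun t => t + t₀) l l) (hf : f =O[l] fun t => Real.exp (b * t)) :
    (fun t => f (t + t₀)) =O[l] fun t => Real.exp (b * t) := by
  refine (hf.comp_tendsto hl).trans ?_
  refine IsBigO.of_bound (Real.exp (b * t₀)) (Eventually.of_forall fun t => ?_)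
  simp only [Function.comp_apply]
  rw [mul_add, Real.exp_add, norm_mul, mul_comm, Real.norm_of_nonneg (Real.exp_pos (b * t₀)).le]

theorem isBigO_mul_exp {l : Filter ℝ} {b : ℝ} {f g : ℝ → ℝ}
    (hf : f =O[l] fun t => Real.exp (b / 2 * t)) (hg : g =O[l] fun t => Real.exp (b / 2 * t)) :
    (fun t => f t * g t) =O[l] fun t => Real.exp (b * t) := by
  refine (hf.mul hg).congr_right fun t => ?_
  rw [← Real.exp_add]
  ring_nf

theorem isBigO_one_of_bound {l : Filter ℝ} {f : ℝ → ℝ} {M : ℝ} (hf : ∀ t, |f t| ≤ M) :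
    f =O[l] fun _ => (1 : ℝ) :=
  IsBigO.of_bound M (Eventually.of_forall fun t => by simpa using hf t)

theorem eventually_sub_lt {x y : ℝ} (hxy : x < y) : ∀ᶠ σ : ℝ in 𝓝[>] 0, x < y - σ := by
  filter_upwards [Ioo_mem_nhdsGT (sub_pos.2 hxy)] with σ hσ
  linarith [hσ.2]

theorem eventually_pos : ∀ᶠ σ : ℝ in 𝓝[>] 0, 0 < σ := self_mem_nhdsWithin

theorem exp_mul_log_div {A l : ℝ} (hA : 0 < A) (hl : l ≠ 0) :
    A * Real.exp (l * (-(Real.log A) / l)) = 1 := by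
  rw [mul_div_cancel₀ _ hl, Real.exp_neg, Real.exp_log hA, mul_inv_cancel₀ hA.ne']

/-! ### Behaviour at `-∞`. -/

namespace IsProfile
variable {h ε l u : ℝ} {w w₁ w₂ : ℝ → ℝ}

theorem hasDerivAt_left (hw : IsProfile h ε w w₁ w₂) (hε : 0 < ε) (hsum : ε * (l + u) = 1)
    (hprod : ε * (l * u) = 1) (t : ℝ) :
    HasDerivAt (fun t => w₁ t - l * w t)
      (u * (w₁ t - l * w t) + w t * w (t - h) / ε) t := by
  refine ((hw.hasDerivAt₁ t).sub ((hw.hasDerivAt t).const_mul l)).congr_deriv ?_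
  field_simp
  linear_combination hw.equation t - w₁ t * hsum + w t * hprod

theorem left_isBigO_one (hw : IsProfile h ε w w₁ w₂) (hε : 0 < ε) (F : Filter ℝ) :
    (fun t => w₁ t - l * w t) =O[F] fun _ => (1 : ℝ) := by
  refine (isBigO_one_of_bound (f := w₁) (M := 1 / ε + 1) fun t => ?_).sub
    ((isBigO_one_of_bound (f := w) (M := 1) fun t => ?_).const_mul_left l)
  · rw [abs_of_nonneg (hw.deriv_nonneg t)]
    exact hw.deriv_le hε t
  · rw [abs_of_pos (hw.pos t)]
    exact hw.le_one t

theorem left_neg (hw : IsProfile h ε w w₁ w₂) (hε : 0 < ε) (hu : 0 < u) (hsum : ε * (l + u) = 1)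
    (hprod : ε * (l * u) = 1) (t : ℝ) : w₁ t - l * w t < 0 :=
  neg_of_bounded_of_forcing_pos (hw.hasDerivAt_left hε hsum hprod) hu
    (hw.left_isBigO_one hε _) (fun _ => div_pos (mul_pos (hw.pos _) (hw.pos _)) hε) t

/-- The function `w - ε w'` has derivative `w (1 - w(· - h))`, which is at least `w / 2` once `w(· -
h) < 1/2`; this gives the rate `1/2`. It controls `w` because `w' < l w`, and `ε l ≤ 1/2` as `l` is
the smaller root. -/
theorem left_isBigO_exp_half (hw : IsProfile h ε w w₁ w₂) (hε : 0 < ε) (hu : 0 < u)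
    (hlu : l ≤ u) (hsum : ε * (l + u) = 1) (hprod : ε * (l * u) = 1) :
    w =O[atBot] fun t => Real.exp (1 / 2 * t) := by
  obtain ⟨T, hT⟩ := eventually_atBot.1 (hw.tendsto_atBot.eventually_lt_const one_half_pos)
  have hd : ∀ t, HasDerivAt (fun t => Real.exp (-(1 / 2) * t) * (w t - ε * w₁ t))
      (Real.exp (-(1 / 2) * t) * ((w₁ t - ε * w₂ t) - 1 / 2 * (w t - ε * w₁ t))) t := fun t =>
    hasDerivAt_exp_neg_mul (f := fun t => (w₁ t - ε * w₂ t) - 1 / 2 * (w t - ε * w₁ t))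
      (((hw.hasDerivAt t).sub ((hw.hasDerivAt₁ t).const_mul ε)).congr_deriv (by simp))
  have hmono : MonotoneOn (fun t => Real.exp (-(1 / 2) * t) * (w t - ε * w₁ t))
      (Set.Iic (T + h)) := by
    apply monotoneOn_of_deriv_nonneg (convex_Iic _)
    · exact fun x _ => (hd x).continuousAt.continuousWithinAt
    · exact fun x _ => (hd x).differentiableAt.differentiableWithinAt
    · intro x hx
      rw [interior_Iic] at hx
      rw [(hd x).deriv]
      refine mul_nonneg (Real.exp_pos _).le ?_
      have h1 : w (x - h) < 1 / 2 := hT _ (by linarith [Set.mem_Iio.1 hx])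
      have h2 := hw.equation x
      have h3 := mul_nonneg hε.le (hw.deriv_nonneg x)
      nlinarith [hw.pos x]
  refine IsBigO.of_bound
    (2 * (Real.exp (-(1 / 2) * (T + h)) * (w (T + h) - ε * w₁ (T + h)))) ?_
  filter_upwards [eventually_le_atBot (T + h)] with t ht
  have h1 := hmono ht Set.self_mem_Iic ht
  simp only at h1
  have h2 := hw.left_neg hε hu hsum hprod t
  have h3 : w t ≤ 2 * (w t - ε * w₁ t) := by
    have h4 : ε * w₁ t ≤ ε * (l * w t) := mul_le_mul_of_nonneg_left (by linarith) hε.le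
    have h5 : ε * l ≤ 1 / 2 := by nlinarith
    nlinarith [hw.pos t]
  rw [Real.norm_of_nonneg (hw.pos t).le, Real.norm_of_nonneg (Real.exp_pos _).le]
  have e : w t - ε * w₁ t =
      Real.exp (-(1 / 2) * t) * (w t - ε * w₁ t) * Real.exp (1 / 2 * t) := by
    linear_combination (-(w t - ε * w₁ t)) * exp_neg_mul_mul_exp (1 / 2) t
  calc w t ≤ 2 * (w t - ε * w₁ t) := h3
    _ = 2 * (Real.exp (-(1 / 2) * t) * (w t - ε * w₁ t) * Real.exp (1 / 2 * t)) := by rw [← e]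
    _ ≤ 2 * (Real.exp (-(1 / 2) * (T + h)) * (w (T + h) - ε * w₁ (T + h)) *
          Real.exp (1 / 2 * t)) := by gcongr
    _ = _ := by ring

theorem left_forcing_isBigO (hw : IsProfile h ε w w₁ w₂) (hh : 0 ≤ h) {b : ℝ}
    (hb : w =O[atBot] fun t => Real.exp (b / 2 * t)) :
    (fun t => w t * w (t - h) / ε) =O[atBot] fun t => Real.exp (b * t) := by
  have h1 : (fun t => w (t - h)) =O[atBot] w := by
    refine IsBigO.of_bound 1 (Eventually.of_forall fun t => ?_)
    rw [Real.norm_of_nonneg (hw.pos _).le, Real.norm_of_nonneg (hw.pos _).le, one_mul]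
    exact hw.monotone (by linarith)
  simp only [div_eq_inv_mul]
  exact (isBigO_mul_exp hb (h1.trans hb)).const_mul_left _

/-- Rate `b / 2` for `w` gives rate `b` for the quadratic forcing, and the two first-order equations
return rate `b` for `w` as long as `b < l ≤ u`. Finitely many doublings starting from `1/2` reach
any such `b`. -/
theorem left_isBigO_exp (hw : IsProfile h ε w w₁ w₂) (hh : 0 ≤ h) (hε : 0 < ε) (hu : 0 < u)
    (hlu : l ≤ u) (hsum : ε * (l + u) = 1) (hprod : ε * (l * u) = 1) {b : ℝ} (hb0 : 0 < b)
    (hbl : b < l) : w =O[atBot] fun t => Real.exp (b * t) := by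
  have key : ∀ n : ℕ, ∀ b, 0 < b → b < l → b ≤ 2 ^ n / 2 →
      w =O[atBot] fun t => Real.exp (b * t) := by
    intro n
    induction n with
    | zero =>
      intro b hb0 hbl hb
      exact (hw.left_isBigO_exp_half hε hu hlu hsum hprod).trans
        (isBigO_exp_atBot (by simpa using hb))
    | succ n ih =>
      intro b hb0 hbl hb
      have h1 := ih (b / 2) (by linarith) (by linarith) (by rw [pow_succ] at hb; linarith)
      have h2 := isBigO_exp_of_lt_atBot (hw.hasDerivAt_left hε hsum hprod) (hbl.trans_le hlu)
        (hw.left_forcing_isBigO hh h1)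
      exact isBigO_exp_of_lt_atBot (f := fun t => w₁ t - l * w t)
        (fun t => (hw.hasDerivAt t).congr_deriv (by ring)) hbl h2
  obtain ⟨n, hn⟩ := pow_unbounded_of_one_lt (2 * b) (one_lt_two (α := ℝ))
  exact key n b hb0 hbl (by linarith)

theorem left_forcing_isBigO_exp (hw : IsProfile h ε w w₁ w₂) (hh : 0 ≤ h) (hε : 0 < ε)
    (hu : 0 < u) (hlu : l ≤ u) (hsum : ε * (l + u) = 1) (hprod : ε * (l * u) = 1) {b : ℝ}
    (hb0 : 0 < b) (hbl : b < 2 * l) :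
    (fun t => w t * w (t - h) / ε) =O[atBot] fun t => Real.exp (b * t) :=
  hw.left_forcing_isBigO hh
    (hw.left_isBigO_exp hh hε hu hlu hsum hprod (by linarith) (by linarith))

/-- `exp (-l t) w` is positive and strictly decreasing, so its limit at `-∞` cannot be `0`. -/
theorem left_limit_pos (hw : IsProfile h ε w w₁ w₂) (hε : 0 < ε) (hu : 0 < u)
    (hsum : ε * (l + u) = 1) (hprod : ε * (l * u) = 1) {A : ℝ}
    (hA : Tendsto (fun t => Real.exp (-l * t) * w t) atBot (𝓝 A)) : 0 < A := by
  have hd : ∀ t, HasDerivAt w (l * w t + (w₁ t - l * w t)) t := fun t =>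
    (hw.hasDerivAt t).congr_deriv (by ring)
  have hanti : StrictAnti fun t => Real.exp (-l * t) * w t :=
    strictAnti_of_deriv_neg fun t => by
      rw [(hasDerivAt_exp_neg_mul (f := fun t => w₁ t - l * w t) (hd t)).deriv]
      exact mul_neg_of_pos_of_neg (Real.exp_pos _) (hw.left_neg hε hu hsum hprod t)
  have := hanti.antitone.ge_of_tendsto hA 0
  have h2 : 0 < Real.exp (-l * 0) * w 0 := mul_pos (Real.exp_pos _) (hw.pos _)
  linarith

/-- The limit of `exp (-u t) (w' - l w)` at `-∞` is negative. -/
theorem left_deriv_limit_neg (hw : IsProfile h ε w w₁ w₂) (hε : 0 < ε) (hu : 0 < u)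
    (hsum : ε * (l + u) = 1) (hprod : ε * (l * u) = 1) {C : ℝ}
    (hC : Tendsto (fun t => Real.exp (-u * t) * (w₁ t - l * w t)) atBot (𝓝 C)) : C < 0 := by
  have hmono := strictMono_of_hasDerivAt_pos
    (fun t => hasDerivAt_exp_neg_mul (f := fun t => w t * w (t - h) / ε)
      (hw.hasDerivAt_left hε hsum hprod t))
    fun t => mul_pos (Real.exp_pos _) (div_pos (mul_pos (hw.pos t) (hw.pos (t - h))) hε)
  have h1 := hmono.monotone.le_of_tendsto hC 0
  have h2 := mul_neg_of_pos_of_neg (Real.exp_pos (-u * 0)) (hw.left_neg hε hu hsum hprod 0)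
  linarith

theorem left_asymptotics_of_two_mul_le (hw : IsProfile h ε w w₁ w₂) (hh : 0 ≤ h) (hε : 0 < ε)
    (hl : 0 < l) (hlu : 2 * l ≤ u) (hsum : ε * (l + u) = 1) (hprod : ε * (l * u) = 1) :
    ∃ t₀ : ℝ, ∀ᶠ σ : ℝ in 𝓝[>] 0, (fun t => w (t + t₀) - Real.exp (l * t))
      =O[atBot] fun t => Real.exp ((2 * l - σ) * t) := by
  have hu : 0 < u := by linarith
  have hp : ∀ b, 0 < b → b < 2 * l →
      (fun t => w₁ t - l * w t) =O[atBot] fun t => Real.exp (b * t) := fun b hb0 hb =>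
    isBigO_exp_of_lt_atBot (hw.hasDerivAt_left hε hsum hprod) (by linarith)
      (hw.left_forcing_isBigO_exp hh hε hu (by linarith) hsum hprod hb0 hb)
  obtain ⟨A, hA, hAO⟩ := exists_isBigO_sub_exp_atBot (y := w) (a := l)
    (f := fun t => w₁ t - l * w t) (fun t => (hw.hasDerivAt t).congr_deriv (by ring))
    ⟨3 / 2 * l, by linarith, hp _ (by linarith) (by linarith)⟩
  have hA0 := hw.left_limit_pos hε hu hsum hprod hA
  -- This shift normalizes the leading coefficient: `A exp (l t₀) = 1`.
  refine ⟨-Real.log A / l, ?_⟩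
  filter_upwards [eventually_pos, eventually_sub_lt (show l < 2 * l by linarith)] with σ hσ0 hσ
  have := isBigO_comp_add_exp (tendsto_atBot_add_const_right _ (-Real.log A / l) tendsto_id)
    (hAO (2 * l - σ) hσ (hp _ (by linarith) (by linarith)))
  refine this.congr_left fun t => ?_
  rw [mul_add, Real.exp_add, mul_left_comm, exp_mul_log_div hA0 hl.ne', mul_one]

theorem left_asymptotics_of_lt_two_mul (hw : IsProfile h ε w w₁ w₂) (hh : 0 ≤ h) (hε : 0 < ε)
    (hl : 0 < l) (hlu : l < u) (hul : u < 2 * l) (hsum : ε * (l + u) = 1)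
    (hprod : ε * (l * u) = 1) :
    ∃ t₀ K₁ : ℝ, 0 < K₁ ∧ ∀ᶠ σ : ℝ in 𝓝[>] 0,
      (fun t => w (t + t₀) - (Real.exp (l * t) - K₁ * Real.exp (u * t)))
        =O[atBot] fun t => Real.exp ((2 * l - σ) * t) := by
  have hu : 0 < u := by linarith
  have hg : ∀ b, 0 < b → b < 2 * l →
      (fun t => w t * w (t - h) / ε) =O[atBot] fun t => Real.exp (b * t) := fun b hb0 hb =>
    hw.left_forcing_isBigO_exp hh hε hu hlu.le hsum hprod hb0 hb
  obtain ⟨C, hC, hCO⟩ := exists_isBigO_sub_exp_atBot (hw.hasDerivAt_left hε hsum hprod)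
    -- The midpoint of `u` and `2 l`; any rate strictly between them would do.
    ⟨l + u / 2, by linarith, hg _ (by linarith) (by linarith)⟩
  have hC0 := hw.left_deriv_limit_neg hε hu hsum hprod hC
  have hd : u - l ≠ 0 := by linarith
  set D := C / (u - l) with hD
  have hD0 : D < 0 := div_neg_of_neg_of_pos hC0 (by linarith)
  have hy : ∀ t, HasDerivAt (fun t => w t - D * Real.exp (u * t))
      (l * (w t - D * Real.exp (u * t)) + (w₁ t - l * w t - C * Real.exp (u * t))) t := by
    intro t
    refine ((hw.hasDerivAt t).sub ((hasDerivAt_exp_mul u t).const_mul D)).congr_deriv ?_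
    have : D * (u - l) = C := by rw [hD]; field_simp
    rw [← this]
    ring
  have hbig : ∀ b, u < b → b < 2 * l → (fun t => w₁ t - l * w t - C * Real.exp (u * t)) =O[atBot]
      fun t => Real.exp (b * t) := fun b hb0 hb => hCO b hb0 (hg b (by linarith) hb)
  obtain ⟨A, hA, hAO⟩ := exists_isBigO_sub_exp_atBot hy
    ⟨l + u / 2, by linarith, hbig _ (by linarith) (by linarith)⟩
  have hA0 : 0 < A := by
    refine hw.left_limit_pos hε hu hsum hprod ?_
    have h1 : Tendsto (fun t => D * Real.exp ((u - l) * t)) atBot (𝓝 0) := by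
      simpa using (tendsto_exp_mul_atBot_zero (sub_pos.2 hlu)).const_mul D
    have h2 := hA.add h1
    rw [add_zero] at h2
    refine h2.congr fun t => ?_
    have : Real.exp ((u - l) * t) = Real.exp (-l * t) * Real.exp (u * t) := by
      rw [← Real.exp_add]; ring_nf
    rw [this]
    ring
  refine ⟨-Real.log A / l, -(D * Real.exp (u * (-Real.log A / l))),
    neg_pos.2 (mul_neg_of_neg_of_pos hD0 (Real.exp_pos _)), ?_⟩
  filter_upwards [eventually_pos, eventually_sub_lt hul] with σ hσ0 hσ
  have := isBigO_comp_add_exp (tendsto_atBot_add_const_right _ (-Real.log A / l) tendsto_id)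
    (hAO (2 * l - σ) (by linarith) (hbig _ hσ (by linarith)))
  refine this.congr_left fun t => ?_
  rw [mul_add, mul_add, Real.exp_add, Real.exp_add]
  linear_combination (-Real.exp (l * t)) * exp_mul_log_div hA0 hl.ne'

theorem left_asymptotics_of_eq (hw : IsProfile h ε w w₁ w₂) (hh : 0 ≤ h) (hε : 0 < ε)
    (hl : 0 < l) (hsum : ε * (l + l) = 1) (hprod : ε * (l * l) = 1) :
    ∃ t₀ K₂ : ℝ, 0 < K₂ ∧ ∀ᶠ σ : ℝ in 𝓝[>] 0,
      (fun t => w (t + t₀) - (-(K₂ * t * Real.exp (l * t))))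
        =O[atBot] fun t => Real.exp ((2 * l - σ) * t) := by
  have hg : ∀ b, 0 < b → b < 2 * l →
      (fun t => w t * w (t - h) / ε) =O[atBot] fun t => Real.exp (b * t) := fun b hb0 hb =>
    hw.left_forcing_isBigO_exp hh hε hl le_rfl hsum hprod hb0 hb
  obtain ⟨C, hC, hCO⟩ := exists_isBigO_sub_exp_atBot (hw.hasDerivAt_left hε hsum hprod)
    ⟨3 / 2 * l, by linarith, hg _ (by linarith) (by linarith)⟩
  have hC0 := hw.left_deriv_limit_neg hε hl hsum hprod hC
  have hy : ∀ t, HasDerivAt (fun t => w t - C * (t * Real.exp (l * t)))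
      (l * (w t - C * (t * Real.exp (l * t))) + (w₁ t - l * w t - C * Real.exp (l * t))) t := by
    intro t
    refine ((hw.hasDerivAt t).sub
      (((hasDerivAt_id t).mul (hasDerivAt_exp_mul l t)).const_mul C)).congr_deriv ?_
    simp only [id]
    ring
  have hbig : ∀ b, l < b → b < 2 * l → (fun t => w₁ t - l * w t - C * Real.exp (l * t)) =O[atBot]
      fun t => Real.exp (b * t) := fun b hb0 hb => hCO b hb0 (hg b (by linarith) hb)
  obtain ⟨B, -, hBO⟩ := exists_isBigO_sub_exp_atBot hy
    ⟨3 / 2 * l, by linarith, hbig _ (by linarith) (by linarith)⟩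
  -- The leading part is `C (t + B / C) exp (l t)`, so the shift `-B / C` removes the pure
  -- exponential, which is larger than the error term.
  refine ⟨-(B / C), -(C * Real.exp (l * -(B / C))),
    neg_pos.2 (mul_neg_of_neg_of_pos hC0 (Real.exp_pos _)), ?_⟩
  filter_upwards [eventually_pos, eventually_sub_lt (show l < 2 * l by linarith)] with σ hσ0 hσ
  have := isBigO_comp_add_exp (tendsto_atBot_add_const_right _ (-(B / C)) tendsto_id)
    (hBO (2 * l - σ) hσ (hbig _ hσ (by linarith)))
  refine this.congr_left fun t => ?_
  have hC0' := hC0.ne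
  rw [mul_add, Real.exp_add]
  field_simp
  ring

end IsProfile

/-! ### Behaviour at `+∞`. -/

theorem integral_kernel_div_lt_one {h ε a b z : ℝ} (hε : 0 < ε) (hz : 0 < quot h ε a b z) :
    ∫ r in (0 : ℝ)..h, kernel h a b r / ε * Real.exp (-z * r) < 1 := by
  have e : ∀ r, kernel h a b r / ε * Real.exp (-z * r) =
      (kernel h a b r * Real.exp (-z * r)) / ε := fun r => by ring
  simp only [e]
  rw [intervalIntegral.integral_div, div_lt_one hε]
  unfold quot at hz
  linarith

theorem quot_pos_of_mem_Ioo {h ε a b z : ℝ} (hb : 0 < b) (hψa : psi h ε a = 0)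
    (hψb : psi h ε b = 0) (hneg : ∀ z, a < z → z ≤ 0 → psi h ε z < 0) (hz : a < z)
    (hz0 : z ≤ 0) : 0 < quot h ε a b z := by
  have h1 := quot_mul (by linarith) hψa hψb z
  have h2 := hneg z hz hz0
  rw [← h1] at h2
  have h3 : (z - a) * (z - b) < 0 := mul_neg_of_pos_of_neg (by linarith) (by linarith)
  exact pos_of_mul_neg_left h2 h3.le

/-- `a < 0 < b` are two zeros of the characteristic function at the positive steady state. -/
structure IsRootPair (h ε a b : ℝ) : Prop where
  delay_nonneg : 0 ≤ h
  eps_pos : 0 < ε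
  neg : a < 0
  pos : 0 < b
  psi_left : psi h ε a = 0
  psi_right : psi h ε b = 0

theorem IsRootPair.lt {h ε a b : ℝ} (hp : IsRootPair h ε a b) : a < b := hp.neg.trans hp.pos

namespace IsProfile

/-- The function `(D - a) (1 - w)`. -/
noncomputable def deficit₁ (a : ℝ) (w w₁ : ℝ → ℝ) (t : ℝ) : ℝ := -w₁ t - a * (1 - w t)

/-- The function `(D - a) (D - b) (1 - w)`. -/
noncomputable def deficit₂ (a b : ℝ) (w w₁ w₂ : ℝ → ℝ) (t : ℝ) : ℝ :=
  -w₂ t - (a + b) * -w₁ t + a * b * (1 - w t)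

/-- The quadratic term of the equation for `1 - w`. -/
noncomputable def forcing (h : ℝ) (w : ℝ → ℝ) (t : ℝ) : ℝ := (1 - w t) * (1 - w (t - h))

variable {h ε a b : ℝ} {w w₁ w₂ : ℝ → ℝ}

theorem hasDerivAt_one_sub (hw : IsProfile h ε w w₁ w₂) (a t : ℝ) :
    HasDerivAt (fun t => 1 - w t) (a * (1 - w t) + deficit₁ a w w₁ t) t := by
  refine ((hw.hasDerivAt t).const_sub 1).congr_deriv ?_
  unfold deficit₁
  ring

theorem hasDerivAt_deficit₁ (hw : IsProfile h ε w w₁ w₂) (a b t : ℝ) :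
    HasDerivAt (deficit₁ a w w₁) (b * deficit₁ a w w₁ t + deficit₂ a b w w₁ w₂ t) t := by
  refine ((hw.hasDerivAt₁ t).neg.sub
    (((hw.hasDerivAt t).const_sub 1).const_mul a)).congr_deriv ?_
  unfold deficit₁ deficit₂
  ring

theorem continuous_deficit₂ (hw : IsProfile h ε w w₁ w₂) (a b : ℝ) :
    Continuous (deficit₂ a b w w₁ w₂) := by
  have := hw.continuous
  have := hw.continuous₁
  have := hw.continuous₂
  unfold deficit₂
  fun_prop

theorem abs_one_sub_le (hw : IsProfile h ε w w₁ w₂) (t : ℝ) : |1 - w t| ≤ 1 := by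
  rw [abs_of_nonneg (sub_nonneg.2 (hw.le_one t))]
  linarith [hw.pos t]

theorem abs_deficit₂_le (hw : IsProfile h ε w w₁ w₂) (hε : 0 < ε) (a b t : ℝ) :
    |deficit₂ a b w w₁ w₂ t| ≤ (1 / ε + 2) / ε + |a + b| * (1 / ε + 1) + |a * b| := by
  have h1 : |-w₂ t| ≤ (1 / ε + 2) / ε := by rw [abs_neg]; exact hw.abs_second_le hε t
  have h2 : |(a + b) * -w₁ t| ≤ |a + b| * (1 / ε + 1) := by
    rw [abs_mul, abs_neg, abs_of_nonneg (hw.deriv_nonneg t)]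
    exact mul_le_mul_of_nonneg_left (hw.deriv_le hε t) (abs_nonneg _)
  have h3 : |a * b * (1 - w t)| ≤ |a * b| := by
    rw [abs_mul]
    exact mul_le_of_le_one_right (abs_nonneg _) (hw.abs_one_sub_le t)
  unfold deficit₂
  exact (abs_add_le _ _).trans (add_le_add ((abs_sub _ _).trans (add_le_add h1 h2)) h3)

theorem deficit₁_isBigO_one (hw : IsProfile h ε w w₁ w₂) (hε : 0 < ε) (a : ℝ) (F : Filter ℝ) :
    deficit₁ a w w₁ =O[F] fun _ => (1 : ℝ) := by
  refine (isBigO_one_of_bound (f := fun t => -w₁ t) (M := 1 / ε + 1) fun t => ?_).sub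
    ((isBigO_one_of_bound (f := fun t => 1 - w t) (M := 1) hw.abs_one_sub_le).const_mul_left a)
  rw [abs_neg, abs_of_nonneg (hw.deriv_nonneg t)]
  exact hw.deriv_le hε t

theorem renewal (hw : IsProfile h ε w w₁ w₂) (hε : 0 < ε) (hab : a < b) (hψa : psi h ε a = 0)
    (hψb : psi h ε b = 0) (t : ℝ) :
    deficit₂ a b w w₁ w₂ t =
      (∫ r in (0 : ℝ)..h, kernel h a b r / ε * deficit₂ a b w w₁ w₂ (t - r))
        - forcing h w t / ε := by
  have h1 := integral_kernel_mul hab hψa hψb (y := fun t => 1 - w t) (y₁ := fun t => -w₁ t)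
    (y₂ := fun t => -w₂ t) (fun t => (hw.hasDerivAt t).const_sub 1)
    (fun t => (hw.hasDerivAt₁ t).neg) hw.continuous₂.neg t
  have e : ∀ r, kernel h a b r / ε * deficit₂ a b w w₁ w₂ (t - r) =
      kernel h a b r * deficit₂ a b w w₁ w₂ (t - r) / ε := fun r => by ring
  simp only [e]
  rw [intervalIntegral.integral_div]
  unfold deficit₂ forcing
  rw [h1]
  field_simp
  linear_combination -hw.equation t

/-- At `z = 0` both `psi` and `(z - a)(z - b) = a b` are negative, so the quotient is positive there
and the kernel has mass below one; `renewal_le_neg` then applies to the bounded function `deficit₂`.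
-/
theorem deficit₂_le (hw : IsProfile h ε w w₁ w₂) (hp : IsRootPair h ε a b)
    (t : ℝ) : deficit₂ a b w w₁ w₂ t ≤ -(forcing h w t / ε) := by
  have ha := hp.neg
  have hb := hp.pos
  have hab := hp.lt
  have hq : 0 < quot h ε a b 0 := by
    have h1 := quot_mul hab hp.psi_left hp.psi_right 0
    rw [psi_zero] at h1
    have h2 : (0 - a) * (0 - b) < 0 := by nlinarith
    exact pos_of_mul_neg_left (by rw [h1]; norm_num) h2.le
  have hθ := integral_kernel_div_lt_one hp.eps_pos hq
  simp only [neg_zero, zero_mul, Real.exp_zero, mul_one] at hθ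
  refine renewal_le_neg hp.delay_nonneg (k := fun r => kernel h a b r / ε)
    (g := fun t => forcing h w t / ε)
    (by fun_prop) (fun r hr => div_nonneg (kernel_nonneg hab hr.2) hp.eps_pos.le)
    (hw.continuous_deficit₂ a b)
    ⟨_, fun t => (le_abs_self _).trans (hw.abs_deficit₂_le hp.eps_pos a b t)⟩
    (hw.renewal hp.eps_pos hab hp.psi_left hp.psi_right) hθ (fun t => ?_) t
  exact div_nonneg (mul_nonneg (sub_nonneg.2 (hw.le_one _)) (sub_nonneg.2 (hw.le_one _)))
      hp.eps_pos.le

theorem deficit₁_nonneg (hw : IsProfile h ε w w₁ w₂) (hp : IsRootPair h ε a b)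
    (t : ℝ) : 0 ≤ deficit₁ a w w₁ t := by
  have := nonpos_of_bounded_of_forcing_nonneg (p := fun t => -deficit₁ a w w₁ t)
    (f := fun t => -deficit₂ a b w w₁ w₂ t) (a := b)
    (fun t => (hw.hasDerivAt_deficit₁ a b t).neg.congr_deriv (by ring)) hp.pos
    (hw.deficit₁_isBigO_one hp.eps_pos a _).neg_left (fun t => ?_) t
  · linarith
  · have h1 := hw.deficit₂_le hp t
    have h2 : 0 ≤ forcing h w t / ε :=
      div_nonneg (mul_nonneg (sub_nonneg.2 (hw.le_one _)) (sub_nonneg.2 (hw.le_one _)))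
      hp.eps_pos.le
    linarith

theorem monotone_exp_mul_one_sub (hw : IsProfile h ε w w₁ w₂) (hp : IsRootPair h ε a b)
    : Monotone fun t => Real.exp (-a * t) * (1 - w t) :=
  monotone_of_hasDerivAt_nonneg
    (fun t => hasDerivAt_exp_neg_mul (f := deficit₁ a w w₁) (hw.hasDerivAt_one_sub a t))
    fun t => mul_nonneg (Real.exp_pos _).le (hw.deficit₁_nonneg hp t)

/-- `exp (-a t) (1 - w)` is nondecreasing and positive far to the left, so it never vanishes. -/
theorem lt_one (hw : IsProfile h ε w w₁ w₂) (hp : IsRootPair h ε a b) (t : ℝ) : w t < 1 := by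
  obtain ⟨T, hT⟩ := (hw.tendsto_atBot.eventually_lt_const one_pos).exists
  rcases le_total t T with h1 | h1
  · exact (hw.monotone h1).trans_lt hT
  · have h2 := hw.monotone_exp_mul_one_sub hp h1
    have h3 : 0 < Real.exp (-a * T) * (1 - w T) := mul_pos (Real.exp_pos _) (sub_pos.2 hT)
    exact sub_pos.1 (pos_of_mul_pos_right (h3.trans_le h2) (Real.exp_pos _).le)

theorem forcing_pos (hw : IsProfile h ε w w₁ w₂) (hp : IsRootPair h ε a b)
    (t : ℝ) : 0 < forcing h w t :=
  mul_pos (sub_pos.2 (hw.lt_one hp _))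
    (sub_pos.2 (hw.lt_one hp _))

theorem right_limit_pos (hw : IsProfile h ε w w₁ w₂) (hp : IsRootPair h ε a b) {A : ℝ}
    (hA : Tendsto (fun t => Real.exp (-a * t) * (1 - w t)) atTop (𝓝 A)) : 0 < A := by
  have h1 := (hw.monotone_exp_mul_one_sub hp).ge_of_tendsto hA 0
  have h2 : 0 < Real.exp (-a * 0) * (1 - w 0) :=
    mul_pos (Real.exp_pos _) (sub_pos.2 (hw.lt_one hp _))
  linarith

/-- A first, crude rate. The function `(1 - w) + ε w'` has derivative `-w (1 - w(· - h))`, at most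
`-(1 - w) / 2` once `w > 1/2`. The inequality `w' ≤ -a (1 - w)` bounds it above by `D (1 - w)` with
`D = 1 - ε a`, which gives the rate `1 / (2 D)`. -/
theorem exists_isBigO_exp_one_sub (hw : IsProfile h ε w w₁ w₂) (hp : IsRootPair h ε a b) :
    ∃ d > 0, (fun t => 1 - w t) =O[atTop] fun t => Real.exp (-d * t) := by
  have ha := hp.neg
  have hε := hp.eps_pos
  have hh := hp.delay_nonneg
  obtain ⟨T, hT⟩ := eventually_atTop.1 (hw.tendsto_atTop.eventually_const_lt one_half_lt_one)
  set D := 1 - ε * a with hD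
  have hD0 : 0 < D := by nlinarith
  set d := 1 / (2 * D) with hd
  have hd0 : 0 < d := by positivity
  refine ⟨d, hd0, ?_⟩
  have hder : ∀ t, HasDerivAt (fun t => Real.exp (-(-d) * t) * ((1 - w t) + ε * w₁ t))
      (Real.exp (-(-d) * t) * ((-w₁ t + ε * w₂ t) - (-d) * ((1 - w t) + ε * w₁ t))) t := fun t =>
    hasDerivAt_exp_neg_mul (f := fun t => (-w₁ t + ε * w₂ t) - (-d) * ((1 - w t) + ε * w₁ t))
      ((((hw.hasDerivAt t).const_sub 1).add ((hw.hasDerivAt₁ t).const_mul ε)).congr_deriv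
        (by simp))
  have hanti : AntitoneOn (fun t => Real.exp (-(-d) * t) * ((1 - w t) + ε * w₁ t))
      (Set.Ici T) := by
    apply antitoneOn_of_deriv_nonpos (convex_Ici _)
    · exact fun x _ => (hder x).continuousAt.continuousWithinAt
    · exact fun x _ => (hder x).differentiableAt.differentiableWithinAt
    · intro x hx
      rw [interior_Ici] at hx
      rw [(hder x).deriv]
      refine mul_nonpos_of_nonneg_of_nonpos (Real.exp_pos _).le ?_
      have h1 : 1 / 2 < w x := hT _ (le_of_lt hx)
      have h2 := hw.equation x
      have h3 := hw.deficit₁_nonneg hp x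
      unfold deficit₁ at h3
      have h4 : (1 - w x) + ε * w₁ x ≤ D * (1 - w x) := by nlinarith
      have h5 : d * ((1 - w x) + ε * w₁ x) ≤ 1 / 2 * (1 - w x) := by
        calc _ ≤ d * (D * (1 - w x)) := mul_le_mul_of_nonneg_left h4 hd0.le
          _ = _ := by rw [hd]; field_simp
      have h6 : 1 - w x ≤ 1 - w (x - h) := by linarith [hw.monotone (show x - h ≤ x by linarith)]
      have h7 : 0 ≤ 1 - w x := sub_nonneg.2 (hw.le_one x)
      nlinarith
  refine IsBigO.of_bound (Real.exp (-(-d) * T) * ((1 - w T) + ε * w₁ T)) ?_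
  filter_upwards [eventually_ge_atTop T] with t ht
  have h1 := hanti Set.self_mem_Ici ht ht
  simp only at h1
  have h2 : 0 ≤ 1 - w t := sub_nonneg.2 (hw.le_one t)
  have h3 := mul_nonneg hp.eps_pos.le (hw.deriv_nonneg t)
  rw [Real.norm_of_nonneg h2, Real.norm_of_nonneg (Real.exp_pos _).le]
  have e : (1 - w t) + ε * w₁ t =
      Real.exp (-(-d) * t) * ((1 - w t) + ε * w₁ t) * Real.exp (-d * t) := by
    linear_combination (-((1 - w t) + ε * w₁ t)) * exp_neg_mul_mul_exp (-d) t
  calc 1 - w t ≤ (1 - w t) + ε * w₁ t := by linarith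
    _ = Real.exp (-(-d) * t) * ((1 - w t) + ε * w₁ t) * Real.exp (-d * t) := e
    _ ≤ _ := by gcongr

theorem forcing_isBigO {z : ℝ}
    (hz : (fun t => 1 - w t) =O[atTop] fun t => Real.exp (z / 2 * t)) :
    forcing h w =O[atTop] fun t => Real.exp (z * t) := by
  have := isBigO_comp_add_exp (tendsto_atTop_add_const_right _ (-h) tendsto_id) hz
  exact isBigO_mul_exp hz this

theorem deficit₂_isBigO (hw : IsProfile h ε w w₁ w₂) (hp : IsRootPair h ε a b)
    {z : ℝ} (hq : 0 < quot h ε a b z)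
    (hz : forcing h w =O[atTop] fun t => Real.exp (z * t)) :
    deficit₂ a b w w₁ w₂ =O[atTop] fun t => Real.exp (z * t) := by
  have hab := hp.lt
  refine renewal_isBigO hp.delay_nonneg (k := fun r => kernel h a b r / ε)
    (G := fun t => -(forcing h w t / ε))
    (by fun_prop) (fun r hr => div_nonneg (kernel_nonneg hab hr.2) hp.eps_pos.le)
    (hw.continuous_deficit₂ a b) (fun t => ?_) (integral_kernel_div_lt_one hp.eps_pos hq) ?_
  · rw [← sub_eq_add_neg]
    exact hw.renewal hp.eps_pos hab hp.psi_left hp.psi_right t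
  · simp only [div_eq_inv_mul]
    exact (hz.const_mul_left _).neg_left

/-- Doubling again: rate `z / 2` for `1 - w` gives rate `z` for the forcing, then for `deficit₂`,
`deficit₁` and `1 - w` in turn. Above `a` the quotient is positive, so the renewal bound is
available. -/
theorem one_sub_isBigO (hw : IsProfile h ε w w₁ w₂) (hp : IsRootPair h ε a b)
    (hneg : ∀ z, a < z → z ≤ 0 → psi h ε z < 0) {z : ℝ} (haz : a < z)
    (hz0 : z < 0) : (fun t => 1 - w t) =O[atTop] fun t => Real.exp (z * t) := by
  have hab := hp.lt
  obtain ⟨d, hd, hdO⟩ := hw.exists_isBigO_exp_one_sub hp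
  have key : ∀ n : ℕ, ∀ z, a < z → z < 0 → -z ≤ 2 ^ n * d →
      (fun t => 1 - w t) =O[atTop] fun t => Real.exp (z * t) := by
    intro n
    induction n with
    | zero =>
      intro z haz hz0 hz
      exact hdO.trans (isBigO_exp_atTop (by rw [pow_zero, one_mul] at hz; linarith))
    | succ n ih =>
      intro z haz hz0 hz
      have h1 := ih (z / 2) (by linarith) (by linarith) (by rw [pow_succ] at hz; linarith)
      have h2 := hw.deficit₂_isBigO hp
        (quot_pos_of_mem_Ioo hp.pos hp.psi_left hp.psi_right hneg haz hz0.le) (forcing_isBigO h1)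
      have h3 := isBigO_exp_of_bounded_atTop (hw.hasDerivAt_deficit₁ a b) hp.pos (hz0.trans hp.pos)
        (hw.deficit₁_isBigO_one hp.eps_pos a _) h2
      exact isBigO_exp_of_lt_atTop (hw.hasDerivAt_one_sub a) haz h3
  obtain ⟨n, hn⟩ := pow_unbounded_of_one_lt (-z / d) (one_lt_two (α := ℝ))
  exact key n z haz hz0 ((div_le_iff₀ hd).1 hn.le)

theorem forcing_isBigO_exp (hw : IsProfile h ε w w₁ w₂) (hp : IsRootPair h ε a b)
    (hneg : ∀ z, a < z → z ≤ 0 → psi h ε z < 0) {z : ℝ}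
    (haz : 2 * a < z) (hz0 : z < 0) : forcing h w =O[atTop] fun t => Real.exp (z * t) :=
  forcing_isBigO (hw.one_sub_isBigO hp hneg (by linarith) (by linarith))

theorem right_asymptotics_of_quot_pos (hw : IsProfile h ε w w₁ w₂) (hp : IsRootPair h ε a b)
    (hneg : ∀ z, a < z → z ≤ 0 → psi h ε z < 0)
    (hq : ∀ z, 2 * a < z → 0 < quot h ε a b z) :
    ∃ t₀ : ℝ, ∀ᶠ σ : ℝ in 𝓝[>] 0, (fun t => w (t + t₀) - (1 - Real.exp (a * t)))
      =O[atTop] fun t => Real.exp ((2 * a + σ) * t) := by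
  have ha := hp.neg
  have hb := hp.pos
  have hab := hp.lt
  have hO : ∀ z, 2 * a < z → z < a → deficit₁ a w w₁ =O[atTop] fun t => Real.exp (z * t) :=
    fun z hz hza => isBigO_exp_of_bounded_atTop (hw.hasDerivAt_deficit₁ a b) hp.pos (by linarith)
      (hw.deficit₁_isBigO_one hp.eps_pos a _) (hw.deficit₂_isBigO hp (hq z hz)
        (hw.forcing_isBigO_exp hp hneg hz (by linarith)))
  obtain ⟨A, hA, hAO⟩ := exists_isBigO_sub_exp_atTop (hw.hasDerivAt_one_sub a)
    ⟨3 / 2 * a, by linarith, hO _ (by linarith) (by linarith)⟩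
  have hA0 := hw.right_limit_pos hp hA
  refine ⟨-Real.log A / a, ?_⟩
  -- The second condition is `σ < -a`, that is `2 a + σ < a`.
  filter_upwards [eventually_pos, eventually_sub_lt (show a < 0 by linarith)] with σ hσ0 hσ
  have := isBigO_comp_add_exp (tendsto_atTop_add_const_right _ (-Real.log A / a) tendsto_id)
    (hAO (2 * a + σ) (by linarith) (hO _ (by linarith) (by linarith)))
  refine this.neg_left.congr_left fun t => ?_
  rw [mul_add, Real.exp_add]
  linear_combination Real.exp (a * t) * exp_mul_log_div hA0 hp.neg.ne

/-- Multiplying by `exp (-z t)` makes the kernel a probability density, because the quotient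
vanishes at `z`. As `2 a < z < 0`, the weighted forcing still decays at `+∞` and the weighted
bounded solution tends to `0` at `-∞`, so `renewal_tendsto` applies. -/
theorem deficit₂_asymptotics (hw : IsProfile h ε w w₁ w₂) (hp : IsRootPair h ε a b)
    (hneg : ∀ z, a < z → z ≤ 0 → psi h ε z < 0) (hh0 : 0 < h) {z : ℝ}
    (haz : 2 * a < z) (hza : z ≤ a) (hq : quot h ε a b z = 0) :
    ∃ L < 0, ∀ᶠ σ : ℝ in 𝓝[>] 0,
      (fun t => deficit₂ a b w w₁ w₂ t - L * Real.exp (z * t))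
        =O[atTop] fun t => Real.exp ((z - σ) * t) := by
  have hε := hp.eps_pos
  have hab := hp.lt
  have hz0 : z < 0 := by linarith
  have hfc := hw.continuous_deficit₂ a b
  set κ : ℝ → ℝ := fun r => kernel h a b r / ε * Real.exp (-z * r) with hκ
  have hκc : Continuous κ := by fun_prop
  have hκ0 : ∀ r ≤ h, 0 ≤ κ r := fun r hr =>
    mul_nonneg (div_nonneg (kernel_nonneg hab hr) hp.eps_pos.le) (Real.exp_pos _).le
  have hκ1 : ∫ r in (0 : ℝ)..h, κ r = 1 := by
    have e : ∀ r, κ r = (kernel h a b r * Real.exp (-z * r)) / ε := fun r => by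
      simp only [hκ]; ring
    simp only [e]
    rw [intervalIntegral.integral_div, div_eq_one_iff_eq hp.eps_pos.ne']
    unfold quot at hq
    linarith
  have hbz : 0 < b - z := by linarith
  have hκle : ∀ r ∈ Set.Icc 0 h, ∀ s ∈ Set.Icc r h, κ s ≤ Real.exp ((b - z) * h) * κ r := by
    intro r hr s hs
    have h1 := kernel_le (h := h) hab hs.1
    have e : Real.exp (b * (s - r)) * Real.exp (-z * s) =
        Real.exp ((b - z) * (s - r)) * Real.exp (-z * r) := by
      rw [← Real.exp_add, ← Real.exp_add]; ring_nf
    calc κ s ≤ Real.exp (b * (s - r)) * kernel h a b r / ε * Real.exp (-z * s) := by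
          simp only [hκ]; gcongr
      _ = kernel h a b r / ε * (Real.exp (b * (s - r)) * Real.exp (-z * s)) := by ring
      _ = Real.exp ((b - z) * (s - r)) * κ r := by rw [e]; simp only [hκ]; ring
      _ ≤ _ := by
        refine mul_le_mul_of_nonneg_right (Real.exp_le_exp.2 ?_) (hκ0 r hr.2)
        exact mul_le_mul_of_nonneg_left (by linarith [hr.1, hs.2]) hbz.le
  have hδ : ∀ r ∈ Set.Icc 0 h, 1 / (h * Real.exp ((b - z) * h)) * ∫ s in r..h, κ s ≤ κ r := by
    intro r hr
    have h1 : ∫ s in r..h, κ s ≤ ∫ _ in r..h, Real.exp ((b - z) * h) * κ r :=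
      intervalIntegral.integral_mono_on hr.2 (hκc.intervalIntegrable _ _)
        intervalIntegrable_const (hκle r hr)
    rw [intervalIntegral.integral_const, smul_eq_mul] at h1
    rw [div_mul_eq_mul_div, one_mul, div_le_iff₀ (by positivity)]
    refine h1.trans ?_
    have h2 : 0 ≤ Real.exp ((b - z) * h) * κ r := mul_nonneg (Real.exp_pos _).le (hκ0 r hr.2)
    nlinarith [hr.1]
  have hexp : ∀ c : ℝ, ∀ f : ℝ → ℝ, f =O[atTop] (fun t => Real.exp (c * t)) →
      (fun t => Real.exp (-z * t) * f t) =O[atTop] fun t => Real.exp ((c - z) * t) := by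
    intro c f hf
    refine ((isBigO_refl (fun t => Real.exp (-z * t)) _).mul hf).congr_right fun t => ?_
    rw [← Real.exp_add]; ring_nf
  have hbot : Tendsto (fun t => Real.exp (-z * t) * deficit₂ a b w w₁ w₂ t) atBot (𝓝 0) := by
    have h1 : (fun t => Real.exp (-z * t) * deficit₂ a b w w₁ w₂ t) =O[atBot]
        fun t => Real.exp (-z * t) * 1 :=
      (isBigO_refl _ _).mul (isBigO_one_of_bound (hw.abs_deficit₂_le hp.eps_pos a b))
    refine h1.trans_tendsto ?_
    simpa only [mul_one] using tendsto_exp_mul_atBot_zero (neg_pos.2 hz0)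
  have heq : ∀ t, Real.exp (-z * t) * deficit₂ a b w w₁ w₂ t =
      (∫ r in (0 : ℝ)..h, κ r * (Real.exp (-z * (t - r)) * deficit₂ a b w w₁ w₂ (t - r)))
        - Real.exp (-z * t) * (forcing h w t / ε) := by
    intro t
    have e : ∀ r, κ r * (Real.exp (-z * (t - r)) * deficit₂ a b w w₁ w₂ (t - r)) =
        Real.exp (-z * t) * (kernel h a b r / ε * deficit₂ a b w w₁ w₂ (t - r)) := by
      intro r
      have : Real.exp (-z * t) = Real.exp (-z * r) * Real.exp (-z * (t - r)) := by
        rw [← Real.exp_add]; ring_nf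
      rw [this]
      simp only [hκ]
      ring
    simp only [e]
    rw [intervalIntegral.integral_const_mul, ← mul_sub,
      ← hw.renewal hp.eps_pos hab hp.psi_left hp.psi_right t]
  have hforcing : (fun t => Real.exp (-z * t) * (forcing h w t / ε)) =O[atTop]
      fun t => Real.exp (-((z - 2 * a) / 2) * t) := by
    have h1 : forcing h w =O[atTop] fun t => Real.exp ((z - (z - 2 * a) / 2) * t) :=
      hw.forcing_isBigO_exp hp hneg (by linarith) (by linarith)
    have h2 := hexp _ (fun t => forcing h w t / ε)
      (by simp only [div_eq_inv_mul]; exact h1.const_mul_left _)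
    refine h2.congr_right fun t => ?_
    ring_nf
  obtain ⟨L, hL, hLO⟩ := renewal_tendsto hh0 (by linarith)
    (show 0 < 1 / (h * Real.exp ((b - z) * h)) by positivity) hκc (fun r hr => hκ0 r hr.2) hκ1 hδ
    (by fun_prop) hbot heq
    (fun t => mul_pos (Real.exp_pos _) (div_pos (hw.forcing_pos hp t) hp.eps_pos)) hforcing
  refine ⟨L, hL, hLO.mono fun σ hσ => ?_⟩
  have := (isBigO_refl (fun t => Real.exp (z * t)) atTop).mul hσ
  refine this.congr (fun t => ?_) fun t => ?_
  · linear_combination deficit₂ a b w w₁ w₂ t * exp_neg_mul_mul_exp z t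
  · rw [← Real.exp_add]; ring_nf

theorem deficit₁_asymptotics (hw : IsProfile h ε w w₁ w₂) (hp : IsRootPair h ε a b)
    (hneg : ∀ z, a < z → z ≤ 0 → psi h ε z < 0) (hh0 : 0 < h) {z : ℝ}
    (haz : 2 * a < z) (hza : z ≤ a) (hq : quot h ε a b z = 0) :
    ∃ N > 0, ∀ᶠ σ : ℝ in 𝓝[>] 0,
      (fun t => deficit₁ a w w₁ t - N * Real.exp (z * t))
        =O[atTop] fun t => Real.exp ((z - σ) * t) := by
  have ha := hp.neg
  have hb := hp.pos
  obtain ⟨L, hL, hLO⟩ := hw.deficit₂_asymptotics hp hneg hh0 haz hza hq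
  have hzb : z - b < 0 := by linarith
  refine ⟨L / (z - b), div_pos_of_neg_of_neg hL hzb, ?_⟩
  filter_upwards [hLO, eventually_pos] with σ hσ hσ0
  refine isBigO_exp_of_bounded_atTop (a := b)
    (f := fun t => deficit₂ a b w w₁ w₂ t - L * Real.exp (z * t)) (fun t => ?_) hp.pos (by linarith)
    ?_ hσ
  · refine ((hw.hasDerivAt_deficit₁ a b t).sub
      ((hasDerivAt_exp_mul z t).const_mul (L / (z - b)))).congr_deriv ?_
    have : L = L / (z - b) * (z - b) := by rw [div_mul_cancel₀ _ hzb.ne]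
    linear_combination Real.exp (z * t) * this
  · refine (hw.deficit₁_isBigO_one hp.eps_pos a _).sub (IsBigO.const_mul_left ?_ _)
    simpa using isBigO_exp_atTop (b := z) (b' := 0) (by linarith)

theorem right_asymptotics_of_lt (hw : IsProfile h ε w w₁ w₂) (hp : IsRootPair h ε a b)
    (hneg : ∀ z, a < z → z ≤ 0 → psi h ε z < 0) (hh0 : 0 < h) {z : ℝ}
    (haz : 2 * a < z) (hza : z < a) (hq : quot h ε a b z = 0) :
    ∃ t₀ K₃ : ℝ, 0 < K₃ ∧ ∀ᶠ σ : ℝ in 𝓝[>] 0,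
      (fun t => w (t + t₀) - (1 - Real.exp (a * t) + K₃ * Real.exp (z * t)))
        =O[atTop] fun t => Real.exp ((z - σ) * t) := by
  obtain ⟨N, hN, hNO⟩ := hw.deficit₁_asymptotics hp hneg hh0 haz hza.le hq
  have hd : z - a < 0 := by linarith
  set D := N / (z - a) with hD
  have hD0 : D < 0 := div_neg_of_pos_of_neg hN hd
  have hy : ∀ t, HasDerivAt (fun t => (1 - w t) - D * Real.exp (z * t))
      (a * ((1 - w t) - D * Real.exp (z * t)) +
        (deficit₁ a w w₁ t - N * Real.exp (z * t))) t := by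
    intro t
    refine ((hw.hasDerivAt_one_sub a t).sub
      ((hasDerivAt_exp_mul z t).const_mul D)).congr_deriv ?_
    have : D * (z - a) = N := by rw [hD, div_mul_cancel₀ _ hd.ne]
    rw [← this]
    ring
  obtain ⟨σ₀, hσ₀, hσ₀'⟩ := (hNO.and eventually_pos).exists
  obtain ⟨A, hA, hAO⟩ := exists_isBigO_sub_exp_atTop hy ⟨z - σ₀, by linarith, hσ₀⟩
  have hA0 : 0 < A := by
    refine hw.right_limit_pos hp ?_
    have h1 : Tendsto (fun t => D * Real.exp ((z - a) * t)) atTop (𝓝 0) := by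
      simpa using (tendsto_exp_mul_atTop_zero hd).const_mul D
    have h2 := hA.add h1
    rw [add_zero] at h2
    refine h2.congr fun t => ?_
    have : Real.exp ((z - a) * t) = Real.exp (-a * t) * Real.exp (z * t) := by
      rw [← Real.exp_add]; ring_nf
    rw [this]
    ring
  -- Signs: `N > 0` and `z < a` make `D` negative, hence `K₃ > 0`.
  refine ⟨-Real.log A / a, -(D * Real.exp (z * (-Real.log A / a))),
    neg_pos.2 (mul_neg_of_neg_of_pos hD0 (Real.exp_pos _)), ?_⟩
  filter_upwards [hNO, eventually_pos] with σ hσ hσ0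
  have := isBigO_comp_add_exp (tendsto_atTop_add_const_right _ (-Real.log A / a) tendsto_id)
    (hAO (z - σ) (by linarith) hσ)
  refine this.neg_left.congr_left fun t => ?_
  rw [mul_add, mul_add, Real.exp_add, Real.exp_add]
  linear_combination (Real.exp (a * t)) * exp_mul_log_div hA0 hp.neg.ne

theorem right_asymptotics_of_double (hw : IsProfile h ε w w₁ w₂) (hp : IsRootPair h ε a b)
    (hneg : ∀ z, a < z → z ≤ 0 → psi h ε z < 0) (hh0 : 0 < h)
    (hq : quot h ε a b a = 0) :
    ∃ t₀ K₄ : ℝ, 0 < K₄ ∧ ∀ᶠ σ : ℝ in 𝓝[>] 0,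
      (fun t => w (t + t₀) - (1 - K₄ * t * Real.exp (a * t)))
        =O[atTop] fun t => Real.exp ((a - σ) * t) := by
  have ha := hp.neg
  obtain ⟨N, hN, hNO⟩ := hw.deficit₁_asymptotics hp hneg hh0 (by linarith)
    le_rfl hq
  have hy : ∀ t, HasDerivAt (fun t => (1 - w t) - N * (t * Real.exp (a * t)))
      (a * ((1 - w t) - N * (t * Real.exp (a * t))) +
        (deficit₁ a w w₁ t - N * Real.exp (a * t))) t := by
    intro t
    refine ((hw.hasDerivAt_one_sub a t).sub
      (((hasDerivAt_id t).mul (hasDerivAt_exp_mul a t)).const_mul N)).congr_deriv ?_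
    simp only [id]
    ring
  obtain ⟨σ₀, hσ₀, hσ₀'⟩ := (hNO.and eventually_pos).exists
  obtain ⟨B, -, hBO⟩ := exists_isBigO_sub_exp_atTop hy ⟨a - σ₀, by linarith, hσ₀⟩
  refine ⟨-(B / N), N * Real.exp (a * -(B / N)), mul_pos hN (Real.exp_pos _), ?_⟩
  filter_upwards [hNO, eventually_pos] with σ hσ hσ0
  have := isBigO_comp_add_exp (tendsto_atTop_add_const_right _ (-(B / N)) tendsto_id)
    (hBO (a - σ) (by linarith) hσ)
  refine this.neg_left.congr_left fun t => ?_
  rw [mul_add, Real.exp_add]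
  field_simp
  ring


end IsProfile

/-! ### The critical curves `ε^*` and `ε^#`. -/

theorem exists_hStarPar_eq {h : ℝ} (hh : Real.exp (-1) < h) :
    ∃ t ∈ Set.Ici (0 : ℝ), hStarPar t = h := by
  have hh0 : 0 < h := (Real.exp_pos _).trans hh
  have hc : Continuous hStarPar := by
    unfold hStarPar
    have : ∀ t : ℝ, 1 + √(4 * t ^ 2 + 1) ≠ 0 := fun t => by positivity
    fun_prop (disch := exact this _)
  have h0 : hStarPar 0 = Real.exp (-1) := by simp [hStarPar]
  -- The exponent in `hStarPar` is at least `-2` for `t ≥ 0`, so `hStarPar t ≥ t exp (-2)`, and this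
  -- equals `h` at the chosen point.
  have h1 : h ≤ hStarPar (h * Real.exp 2) := by
    set t := h * Real.exp 2 with ht
    have ht0 : 0 < t := by positivity
    have hs : 2 * t ≤ √(4 * t ^ 2 + 1) := Real.le_sqrt_of_sq_le (by nlinarith)
    have h2 : 2 * t / (1 + √(4 * t ^ 2 + 1)) ≤ 1 := by
      rw [div_le_one (by positivity)]
      linarith
    have h3 : Real.exp (-2) ≤ Real.exp (-1 - 2 * t / (1 + √(4 * t ^ 2 + 1))) :=
      Real.exp_le_exp.2 (by linarith)
    have h4 : h = t * Real.exp (-2) := by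
      rw [ht, mul_assoc, ← Real.exp_add]; simp
    rw [h4]
    unfold hStarPar
    exact mul_le_mul (by linarith) h3 (Real.exp_pos _).le (by positivity)
  obtain ⟨t, ht, htv⟩ := intermediate_value_Icc (by positivity : (0 : ℝ) ≤ h * Real.exp 2)
    hc.continuousOn ⟨h0.trans_le hh.le, h1⟩
  exact ⟨t, ht.1, htv⟩

/-- On the curve `ε = ε^*(h)` the characteristic function has a double negative zero. -/
theorem exists_double_zero {h : ℝ} (hh : Real.exp (-1) < h) :
    0 < epsStar h ∧ ∃ z < 0, psi h (epsStar h) z = 0 ∧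
      2 * epsStar h * z - 1 + h * Real.exp (-(z * h)) = 0 := by
  have hh0 : 0 < h := (Real.exp_pos _).trans hh
  have hex := exists_hStarPar_eq hh
  set t := Function.invFunOn hStarPar (Set.Ici 0) h with ht
  have ht0 : 0 ≤ t := Function.invFunOn_mem hex
  have hth : hStarPar t = h := Function.invFunOn_eq hex
  have ht1 : 0 < t := by
    refine lt_of_le_of_ne ht0 fun e => ?_
    rw [← e] at hth
    simp only [hStarPar] at hth
    norm_num at hth
    exact hh.ne hth
  have he : epsStar h = t * h := rfl
  set s := √(4 * t ^ 2 + 1) with hs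
  have hs0 : 0 ≤ s := Real.sqrt_nonneg _
  have hs2 : s ^ 2 = 4 * t ^ 2 + 1 := Real.sq_sqrt (by positivity)
  set y := 2 * t / (1 + s) with hy
  have hy1 : y * (1 + s) = 2 * t := div_mul_cancel₀ _ (by positivity)
  have hy0 : 0 ≤ y := by positivity
  have hy2 : 2 * t * y = s - 1 := by
    have : (1 + s) ≠ 0 := by positivity
    refine mul_right_cancel₀ this ?_
    linear_combination 2 * t * hy1 - hs2
  have hexp : h * Real.exp (1 + y) = 2 * t + s := by
    rw [← hth]
    unfold hStarPar
    rw [mul_assoc, ← hs, ← hy, ← Real.exp_add]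
    simp
  have hzh : -(-(1 + y) / h * h) = 1 + y := by field_simp
  rw [he]
  -- The double zero is `-(1 + y) / h`: the parametrization says exactly that `h exp (1 + y) = 2 t +
  -- s`, and the rest is algebra with `y (1 + s) = 2 t` and `2 t y = s - 1`.
  refine ⟨by positivity, -(1 + y) / h, div_neg_of_neg_of_pos (by linarith) hh0, ?_, ?_⟩
  · unfold psi
    rw [hzh]
    refine mul_left_cancel₀ hh0.ne' ?_
    rw [mul_sub, hexp]
    field_simp
    linear_combination (1 + y / 2) * hy2 + 1 / 2 * hy1
  · rw [hzh, hexp]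
    field_simp
    linear_combination -hy2

theorem hSharpPar_strictMonoOn : StrictMonoOn hSharpPar (Set.Ioo (-2) 0) := by
  intro s hs t ht hst
  have h1 : √(2 * s + 4) ≤ √(2 * t + 4) := Real.sqrt_le_sqrt (by linarith)
  have h2 : 0 ≤ √(2 * s + 4) := Real.sqrt_nonneg _
  have h3 : Real.log (2 + √(2 * s + 4)) ≤ Real.log (2 + √(2 * t + 4)) :=
    Real.log_le_log (by linarith) (by linarith)
  have h4 : 0 < Real.log (2 + √(2 * s + 4)) := Real.log_pos (by linarith)
  unfold hSharpPar
  rw [← div_neg, ← div_neg]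
  exact div_lt_div₀' h3 (by linarith) (by linarith) (by linarith [ht.2])

theorem epsSharpPar_strictMonoOn : StrictMonoOn epsSharpPar (Set.Ioo (-2) 0) := by
  intro s hs t ht hst
  have h1 : √(2 * s + 4) ≤ √(2 * t + 4) := Real.sqrt_le_sqrt (by linarith)
  have h2 : 0 ≤ √(2 * s + 4) := Real.sqrt_nonneg _
  have ht0 : 0 < t ^ 2 := by have := ht.2.ne; positivity
  unfold epsSharpPar
  exact div_lt_div₀ (by linarith) (by nlinarith [ht.2]) (by linarith [hs.1, ht.1]) ht0

theorem exists_hSharpPar_eq {h : ℝ} (hh : Real.log 2 / 2 < h) :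
    ∃ t ∈ Set.Ioo (-2 : ℝ) 0, hSharpPar t = h := by
  have hl : 0 < Real.log 2 := Real.log_pos one_lt_two
  have hh0 : 0 < h := by linarith
  set t₁ := -min 1 (Real.log 2 / h) with ht₁
  have hm : 0 < min 1 (Real.log 2 / h) := lt_min one_pos (by positivity)
  have ht₁0 : t₁ < 0 := by linarith
  have ht₁1 : -2 ≤ t₁ := by linarith [min_le_left 1 (Real.log 2 / h)]
  have hc : ContinuousOn hSharpPar (Set.Icc (-2) t₁) := by
    unfold hSharpPar
    refine (ContinuousOn.div ?_ continuousOn_id fun t ht => ?_).neg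
    · refine ContinuousOn.log (by fun_prop) fun t _ => by positivity
    · exact (ht.2.trans_lt ht₁0).ne
  have h1 : hSharpPar (-2) = Real.log 2 / 2 := by
    unfold hSharpPar
    norm_num
    ring
  have h2 : h ≤ hSharpPar t₁ := by
    unfold hSharpPar
    rw [← div_neg, le_div_iff₀ (by linarith), ht₁, neg_neg]
    have h3 : h * min 1 (Real.log 2 / h) ≤ Real.log 2 := by
      calc _ ≤ h * (Real.log 2 / h) := mul_le_mul_of_nonneg_left (min_le_right _ _) hh0.le
        _ = _ := mul_div_cancel₀ _ hh0.ne'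
    exact h3.trans (Real.log_le_log two_pos (by linarith [Real.sqrt_nonneg (2 * t₁ + 4)]))
  obtain ⟨t, ht, htv⟩ := intermediate_value_Icc ht₁1 hc ⟨h1.trans_le hh.le, h2⟩
  refine ⟨t, ⟨lt_of_le_of_ne ht.1 fun e => ?_, ht.2.trans_lt ht₁0⟩, htv⟩
  rw [← e, h1] at htv
  exact hh.ne htv

theorem exists_epsSharpPar_eq : ∃ t ∈ Set.Ioo (-2 : ℝ) 0, epsSharpPar t = 1 / 4 := by
  have hc : ContinuousOn epsSharpPar (Set.Icc (-2) (-1)) := by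
    unfold epsSharpPar
    refine ContinuousOn.div (by fun_prop) (by fun_prop) fun t ht => ?_
    have : t ≠ 0 := by linarith [ht.2]
    positivity
  have h1 : epsSharpPar (-2) = 0 := by
    unfold epsSharpPar
    norm_num
  have h2 : 1 / 4 ≤ epsSharpPar (-1) := by
    unfold epsSharpPar
    norm_num
    linarith [Real.sqrt_nonneg 2]
  obtain ⟨t, ht, htv⟩ := intermediate_value_Icc (by norm_num) hc
    ⟨h1.trans_le (by norm_num), h2⟩
  refine ⟨t, ⟨lt_of_le_of_ne ht.1 fun e => ?_, by linarith [ht.2]⟩, htv⟩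
  rw [← e, h1] at htv
  norm_num at htv

/-- On the curve `ε = ε^#(h)` the characteristic function has negative zeros `z` and `2 z`. -/
theorem exists_zero_two_mul_zero {h : ℝ} (hh : Real.log 2 / 2 < h) :
    0 < epsSharp h ∧ (h0 < h → 1 / 4 < epsSharp h) ∧
      ∃ z < 0, psi h (epsSharp h) z = 0 ∧ psi h (epsSharp h) (2 * z) = 0 := by
  have hex := exists_hSharpPar_eq hh
  set t := Function.invFunOn hSharpPar (Set.Ioo (-2) 0) h with ht
  have htm : t ∈ Set.Ioo (-2 : ℝ) 0 := Function.invFunOn_mem hex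
  have hth : hSharpPar t = h := Function.invFunOn_eq hex
  have he : epsSharp h = epsSharpPar t := rfl
  have htn := htm.2.ne
  rw [he]
  -- The curve parameter `t` is itself the zero: `exp (-t h) = 2 + S`, and squaring gives the
  -- exponential at `2 t`.
  refine ⟨?_, fun hlt => ?_, t, htm.2, ?_⟩
  · unfold epsSharpPar
    have := htm.1
    have : 0 < t + 2 := by linarith
    positivity
  · have hex' := exists_epsSharpPar_eq
    rw [← hth, h0] at hlt
    set t₀ := Function.invFunOn epsSharpPar (Set.Ioo (-2) 0) (1 / 4)
    have htm' : t₀ ∈ Set.Ioo (-2 : ℝ) 0 := Function.invFunOn_mem hex'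
    have hth' : epsSharpPar t₀ = 1 / 4 := Function.invFunOn_eq hex'
    rw [← hth']
    exact epsSharpPar_strictMonoOn htm' htm
      ((hSharpPar_strictMonoOn.lt_iff_lt htm' htm).1 hlt)
  · set S := √(2 * t + 4) with hS
    have hS0 : 0 ≤ S := Real.sqrt_nonneg _
    have hS2 : S ^ 2 = 2 * t + 4 := Real.sq_sqrt (by linarith [htm.1])
    have h1 : t * h = -Real.log (2 + S) := by
      rw [← hth]
      unfold hSharpPar
      rw [← hS]
      field_simp
    have h2 : Real.exp (-(t * h)) = 2 + S := by
      rw [h1, neg_neg, Real.exp_log (by linarith)]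
    have h3 : Real.exp (-(2 * t * h)) = (2 + S) ^ 2 := by
      rw [← h2, ← Real.exp_nat_mul]
      congr 1
      push_cast
      ring
    have h4 : epsSharpPar t * t ^ 2 = t + 2 + S := by
      unfold epsSharpPar
      rw [← hS, div_mul_cancel₀ _ (by positivity)]
    constructor
    · unfold psi
      rw [h2]
      linear_combination h4
    · unfold psi
      rw [h3]
      linear_combination 4 * h4 - hS2

/-! ### Position of the velocity relative to the critical velocities. -/

section
variable {h c : ℝ}

theorem eps_pos (hc : 0 < c) : 0 < eps c := by
  unfold eps
  positivity

theorem le_eps_of_le_one_div_sqrt {E : ℝ} (hc : 0 < c) (hE : 0 < E) (hle : c ≤ 1 / √E) :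
    E ≤ eps c := by
  have hs : 0 < √E := Real.sqrt_pos.2 hE
  have hs2 : √E ^ 2 = E := Real.sq_sqrt hE.le
  rw [le_div_iff₀ hs] at hle
  unfold eps
  rw [le_div_iff₀ (by positivity)]
  nlinarith [mul_pos hc hs]

theorem eps_lt_of_one_div_sqrt_lt {E : ℝ} (hE : 0 < E) (hlt : 1 / √E < c) : eps c < E := by
  have hs : 0 < √E := Real.sqrt_pos.2 hE
  have hc : 0 < c := (by positivity : 0 < 1 / √E).trans hlt
  have hs2 : √E ^ 2 = E := Real.sq_sqrt hE.le
  rw [div_lt_iff₀ hs] at hlt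
  unfold eps
  rw [div_lt_iff₀ (by positivity)]
  nlinarith [mul_pos hc hs]

theorem lt_eps_of_lt_one_div_sqrt {E : ℝ} (hc : 0 < c) (hE : 0 < E) (hlt : c < 1 / √E) :
    E < eps c := by
  have hs : 0 < √E := Real.sqrt_pos.2 hE
  have hs2 : √E ^ 2 = E := Real.sq_sqrt hE.le
  rw [lt_div_iff₀ hs] at hlt
  unfold eps
  rw [lt_div_iff₀ (by positivity)]
  nlinarith [mul_pos hc hs]

theorem eps_one_div_sqrt {E : ℝ} (hE : 0 < E) : eps (1 / √E) = E := by
  unfold eps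
  rw [div_pow, Real.sq_sqrt hE.le]
  simp

theorem psi_neg_of_lam2_lt {z : ℝ} (hz : lam2 h c < z) (hz0 : z ≤ 0) : psi h (eps c) z < 0 := by
  rcases hz0.eq_or_lt with rfl | hz0
  · rw [psi_zero]
    norm_num
  · by_contra! hp
    exact hz.not_ge (le_lam2 hz0 hp)

/-- For such delays `psi` is nonnegative at `-2`, so `a = lam2 h c ≥ -2` and `W = exp (-a h) ≤ 2`.
With `W = ε a² - a`, the value of `psi` at `2 a` is `2 W - W² + 2 ε a² ≥ 0`. -/
theorem exists_psi_nonneg_of_delay_le (hh : 0 ≤ h) (hc : 0 < c) (hle : h ≤ Real.log 2 / 2) :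
    (negZeros h c).Nonempty ∧ ∃ z ≤ 2 * lam2 h c, 0 ≤ psi h (eps c) z := by
  have hε := eps_pos hc
  have h2 : 0 ≤ psi h (eps c) (-2) := by
    have : Real.exp (-(-2 * h)) ≤ 2 := by
      calc _ ≤ Real.exp (Real.log 2) := Real.exp_le_exp.2 (by linarith)
        _ = 2 := Real.exp_log two_pos
    unfold psi
    linarith
  have hne := negZeros_nonempty (h := h) (c := c) (by norm_num) h2
  have hm := lam2_mem hne
  have hle2 : -2 ≤ lam2 h c := le_lam2 (by norm_num) h2
  refine ⟨hne, _, le_rfl, ?_⟩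
  have h0 := hm.1
  have hz := hm.2
  set a := lam2 h c
  have hw2 : Real.exp (-(a * h)) ≤ 2 := by
    calc _ ≤ Real.exp (Real.log 2) := Real.exp_le_exp.2 (by nlinarith)
      _ = 2 := Real.exp_log two_pos
  have hw0 := Real.exp_pos (-(a * h))
  have e : Real.exp (-(2 * a * h)) = Real.exp (-(a * h)) ^ 2 := by
    rw [← Real.exp_nat_mul]
    congr 1
    push_cast
    ring
  unfold psi at hz ⊢
  rw [e]
  have h3 : 0 ≤ eps c * a ^ 2 := by positivity
  nlinarith

/-- Raising `ε` above `ε^#` keeps `psi` nonnegative at the zeros `z` and `2 z`. The first gives `z ≤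
λ₂`, so `2 z` is a point not exceeding `2 λ₂`. -/
theorem exists_psi_nonneg_of_epsSharp_le (hlt : Real.log 2 / 2 < h) (hle : epsSharp h ≤ eps c) :
    (negZeros h c).Nonempty ∧ ∃ z ≤ 2 * lam2 h c, 0 ≤ psi h (eps c) z := by
  obtain ⟨-, -, z, hz, hz1, hz2⟩ := exists_zero_two_mul_zero hlt
  have key : ∀ x, psi h (epsSharp h) x = 0 → 0 ≤ psi h (eps c) x := by
    intro x hx
    rw [← add_sub_cancel (epsSharp h) (eps c), psi_add, hx, zero_add]
    exact mul_nonneg (sub_nonneg.2 hle) (sq_nonneg x)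
  exact ⟨negZeros_nonempty hz (key z hz1), 2 * z, by linarith [le_lam2 hz (key z hz1)],
    key _ hz2⟩

/-- Raising `ε` to `ε^#` makes `psi` positive at `z₁` and `z₂`, so both lie in `(2 z, z)`; hence `2
z₂ < 2 z < z₁`. -/
theorem two_mul_lt_of_eps_lt_epsSharp (hlt : Real.log 2 / 2 < h) (hε : eps c < epsSharp h)
    {z₁ z₂ : ℝ} (h12 : z₁ < z₂) (h2 : z₂ < 0) (hz₁ : psi h (eps c) z₁ = 0)
    (hz₂ : psi h (eps c) z₂ = 0) : 2 * z₂ < z₁ := by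
  have hh0 : 0 < h := by linarith [Real.log_pos one_lt_two]
  obtain ⟨hpos, -, z, hz, hz1, hz2⟩ := exists_zero_two_mul_zero hlt
  have key : ∀ x < 0, psi h (eps c) x = 0 → 0 < psi h (epsSharp h) x := by
    intro x hx hx0
    rw [← add_sub_cancel (eps c) (epsSharp h), psi_add, hx0, zero_add]
    have := hx.ne
    exact mul_pos (sub_pos.2 hε) (by positivity)
  have h3 := mem_Ioo_of_psi_pos hh0 hpos (by linarith) hz hz2 hz1 (h12.trans h2)
    (key _ (h12.trans h2) hz₁)
  have h4 := mem_Ioo_of_psi_pos hh0 hpos (by linarith) hz hz2 hz1 h2 (key _ h2 hz₂)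
  linarith [h3.1, h4.2]

theorem exists_psi_pos_of_lt_cStar (hh : 0 < h) (hc : 0 < c) (hlt : (c : EReal) < cStar h) :
    ∃ z < 0, 0 < psi h (eps c) z := by
  have hε := eps_pos hc
  unfold cStar at hlt
  split_ifs at hlt with hle
  -- At `-1 / h` the exponential equals `e`, and `h ≤ 1/e` means `1 / h ≥ e`.
  · refine ⟨-1 / h, div_neg_of_neg_of_pos (by norm_num) hh, ?_⟩
    unfold psi
    have e1 : -(-1 / h * h) = 1 := by field_simp
    have h1 : Real.exp 1 ≤ 1 / h := by
      rw [le_div_iff₀ hh]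
      calc Real.exp 1 * h ≤ Real.exp 1 * Real.exp (-1) := by gcongr
        _ = 1 := by rw [← Real.exp_add]; simp
    have h2 : 0 < eps c * (-1 / h) ^ 2 := by positivity
    rw [e1, neg_div]
    rw [neg_div] at h2
    linarith
  · obtain ⟨hpos, z, hz, hz0, -⟩ := exists_double_zero (not_le.1 hle)
    have h1 := lt_eps_of_lt_one_div_sqrt hc hpos (EReal.coe_lt_coe_iff.1 hlt)
    refine ⟨z, hz, ?_⟩
    rw [← add_sub_cancel (epsStar h) (eps c), psi_add, hz0, zero_add]
    have := hz.ne
    exact mul_pos (sub_pos.2 h1) (by positivity)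

end

variable {h c : ℝ} {w w₁ w₂ : ℝ → ℝ}

theorem four_mul_eps_le_one (hc : 2 ≤ c) : 4 * eps c ≤ 1 := by
  unfold eps
  rw [mul_one_div, div_le_one (by positivity)]
  nlinarith

theorem eps_mul_lam_add_mu (hc : 0 < c) : eps c * (lam c + mu c) = 1 := by
  have := (eps_pos hc).ne'
  unfold lam mu
  field_simp
  ring

theorem eps_mul_lam_mul_mu (hc : 2 ≤ c) : eps c * (lam c * mu c) = 1 := by
  have := (eps_pos (c := c) (by linarith)).ne'
  have hs : √(1 - 4 * eps c) ^ 2 = 1 - 4 * eps c :=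
    Real.sq_sqrt (by linarith [four_mul_eps_le_one hc])
  unfold lam mu
  generalize √(1 - 4 * eps c) = s at hs ⊢
  field_simp
  linear_combination -hs

theorem lam_pos (hc : 2 ≤ c) : 0 < lam c := by
  have hε := eps_pos (c := c) (by linarith)
  have : √(1 - 4 * eps c) < 1 := by
    rw [Real.sqrt_lt' one_pos]
    linarith
  unfold lam
  exact div_pos (by linarith) (by linarith)

theorem lam_two_eq_mu_two : mu 2 = lam 2 := by
  unfold lam mu eps
  norm_num

theorem lam_lt_mu (hc : 2 < c) : lam c < mu c := by
  have hε := eps_pos (c := c) (by linarith)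
  have h4 : 4 * eps c < 1 := by
    unfold eps
    rw [mul_one_div, div_lt_one (by positivity)]
    nlinarith
  have : 0 < √(1 - 4 * eps c) := Real.sqrt_pos.2 (by linarith)
  unfold lam mu
  exact div_lt_div_of_pos_right (by linarith) (by linarith)

/-- `μ < 2λ` amounts to `√(1 - 4ε) < 1/3`, that is `ε > 2/9`, that is `c < 3/√2`. -/
theorem mu_lt_two_mul_lam (hc : 2 < c) (hc' : c < 3 / 2 * √2) : mu c < 2 * lam c := by
  have hε := eps_pos (c := c) (by linarith)
  have h2 : √2 ^ 2 = 2 := Real.sq_sqrt (by norm_num)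
  have h9 : 2 / 9 < eps c := by
    unfold eps
    rw [lt_div_iff₀ (by positivity)]
    nlinarith [Real.sqrt_nonneg 2]
  have : √(1 - 4 * eps c) < 1 / 3 := by
    rw [Real.sqrt_lt' (by norm_num)]
    linarith
  unfold lam mu
  rw [← mul_div_assoc]
  exact div_lt_div_of_pos_right (by linarith) (by linarith)

theorem two_le_of_le {c : ℝ} (hc : 3 / 2 * √2 ≤ c) : 2 ≤ c := by
  have : (4 / 3 : ℝ) ≤ √2 := Real.le_sqrt_of_sq_le (by norm_num)
  linarith

theorem two_mul_lam_le_mu (hc : 3 / 2 * √2 ≤ c) : 2 * lam c ≤ mu c := by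
  have hε := eps_pos (c := c) (by linarith [two_le_of_le hc])
  have h2 : √2 ^ 2 = 2 := Real.sq_sqrt (by norm_num)
  have h9 : eps c ≤ 2 / 9 := by
    unfold eps
    rw [div_le_iff₀ (by have := two_le_of_le hc; positivity)]
    nlinarith [Real.sqrt_nonneg 2]
  have : 1 / 3 ≤ √(1 - 4 * eps c) := Real.le_sqrt_of_sq_le (by linarith)
  unfold lam mu
  rw [← mul_div_assoc]
  exact div_le_div_of_nonneg_right (by linarith) (by linarith)

/-- Supplies `0 < c` in the case `c^# < c < c^*`, where no lower bound for the velocity is assumed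
directly. -/
theorem cSharp_nonneg (h : ℝ) : 0 ≤ cSharp h := by
  unfold cSharp
  split_ifs
  · exact le_top
  · exact EReal.coe_nonneg.2 (by positivity)
  · norm_num

theorem epsSharp_le_eps (hc : 0 < c) (hlt : Real.log 2 / 2 < h) (hle : h ≤ h0)
    (hcs : (c : EReal) ≤ cSharp h) : epsSharp h ≤ eps c := by
  unfold cSharp at hcs
  rw [if_neg hlt.not_ge, if_pos hle, EReal.coe_le_coe_iff] at hcs
  exact le_eps_of_le_one_div_sqrt hc (exists_zero_two_mul_zero hlt).1 hcs

theorem eps_lt_epsSharp (hlt : Real.log 2 / 2 < h) (hcs : cSharp h < (c : EReal)) :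
    eps c < epsSharp h := by
  obtain ⟨hpos, h14, -⟩ := exists_zero_two_mul_zero hlt
  unfold cSharp at hcs
  rw [if_neg hlt.not_ge] at hcs
  split_ifs at hcs with hle
  · exact eps_lt_of_one_div_sqrt_lt hpos (EReal.coe_lt_coe_iff.1 hcs)
  -- For `h > h0` the threshold is `2`, and `eps c ≤ 1/4 < epsSharp h`.
  · have hc2 : (2 : ℝ) < c := EReal.coe_lt_coe_iff.1 hcs
    refine lt_of_le_of_lt ?_ (h14 (not_le.1 hle))
    linarith [four_mul_eps_le_one hc2.le]

theorem exists_isRootPair (hh : 0 ≤ h) (hc : 0 < c) {a : ℝ} (ha : a < 0)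
    (ha0 : psi h (eps c) a = 0) : ∃ b, IsRootPair h (eps c) a b := by
  obtain ⟨b, hb, hb0⟩ := exists_pos_zero hh (eps_pos hc)
  exact ⟨b, hh, eps_pos hc, ha, hb, ha0, hb0⟩

/-- Left of `λ₂` the factor `(z - λ₂)(z - b)` is positive, so `psi ≥ 0` at one point `z ≤ 2 λ₂`
makes the quotient nonnegative there, hence positive on `(2 λ₂, ∞)`. -/
theorem IsProfile.right_asymptotics_of_psi_nonneg (hw : IsProfile h (eps c) w w₁ w₂) (hh : 0 ≤ h)
    (hc : 0 < c) (hne : (negZeros h c).Nonempty)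
    (hz : ∃ z ≤ 2 * lam2 h c, 0 ≤ psi h (eps c) z) :
    ∃ t₀ : ℝ, ∀ᶠ σ : ℝ in 𝓝[>] 0, (fun t => w (t + t₀) - (1 - Real.exp (lam2 h c * t)))
      =O[atTop] fun t => Real.exp ((2 * lam2 h c + σ) * t) := by
  obtain ⟨ha, ha0⟩ := lam2_mem hne
  obtain ⟨b, hp⟩ := exists_isRootPair hh hc ha ha0
  obtain ⟨z, hz, hz0⟩ := hz
  refine hw.right_asymptotics_of_quot_pos hp (fun _ => psi_neg_of_lam2_lt) fun x hx => ?_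
  refine quot_pos_of_lt hh hp.eps_pos hp.lt ?_ (hz.trans_lt hx)
  have h1 := quot_mul hp.lt hp.psi_left hp.psi_right z
  have hlt := hp.lt
  have h2 : 0 < (z - lam2 h c) * (z - b) := mul_pos_of_neg_of_neg (by linarith) (by linarith)
  rw [← h1] at hz0
  exact nonneg_of_mul_nonneg_left hz0 h2

theorem IsProfile.right_asymptotics_of_mem_Ioo (hw : IsProfile h (eps c) w w₁ w₂) (hc : 0 < c)
    (hlt : Real.log 2 / 2 < h) (hcs : cSharp h < (c : EReal)) (hcS : (c : EReal) < cStar h) :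
    ∃ t₀ K₃ : ℝ, 0 < K₃ ∧ ∀ᶠ σ : ℝ in 𝓝[>] 0,
      (fun t => w (t + t₀)
          - (1 - Real.exp (lam2 h c * t) + K₃ * Real.exp (lam1 h c * t)))
        =O[atTop] fun t => Real.exp ((lam1 h c - σ) * t) := by
  have hh : 0 < h := by linarith [Real.log_pos one_lt_two]
  have hε := eps_pos hc
  obtain ⟨z, hz, hzp⟩ := exists_psi_pos_of_lt_cStar hh hc hcS
  obtain ⟨z₁, hz₁, hz₁0⟩ := exists_zero_lt hh hzp
  obtain ⟨z₂, hz₂, hz₂n, hz₂0⟩ := exists_zero_ge hz hzp.le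
  have h12 : z₁ < z₂ := hz₁.trans_le hz₂
  obtain ⟨e1, e2⟩ := lam1_lam2_eq hh hε h12 hz₂n hz₁0 hz₂0
  have h2 := two_mul_lt_of_eps_lt_epsSharp hlt (eps_lt_epsSharp hlt hcs) h12 hz₂n hz₁0 hz₂0
  obtain ⟨b, hp⟩ := exists_isRootPair hh.le hc hz₂n hz₂0
  have hq : quot h (eps c) z₂ b z₁ = 0 := by
    have h1 := quot_mul hp.lt hp.psi_left hp.psi_right z₁
    have hltb := hp.lt
    rw [hz₁0, mul_eq_zero] at h1
    exact h1.resolve_right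
      (mul_pos_of_neg_of_neg (by linarith) (by linarith) : 0 < (z₁ - z₂) * (z₁ - b)).ne'
  rw [e1, e2]
  exact hw.right_asymptotics_of_lt hp (fun x hx => psi_neg_of_lam2_lt (e2.trans_lt hx)) hh h2 h12 hq

theorem IsProfile.right_asymptotics_of_eq_cStar (hw : IsProfile h (eps c) w w₁ w₂)
    (hlt : Real.exp (-1) < h) (hc : c = 1 / √(epsStar h)) :
    ∃ t₀ K₄ : ℝ, 0 < K₄ ∧ ∀ᶠ σ : ℝ in 𝓝[>] 0,
      (fun t => w (t + t₀) - (1 - K₄ * t * Real.exp (lam2 h c * t)))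
        =O[atTop] fun t => Real.exp ((lam2 h c - σ) * t) := by
  have hh : 0 < h := (Real.exp_pos _).trans hlt
  obtain ⟨hpos, z, hz, hz0, hz0'⟩ := exists_double_zero hlt
  have hc0 : 0 < c := by rw [hc]; positivity
  have he : eps c = epsStar h := by rw [hc, eps_one_div_sqrt hpos]
  rw [← he] at hz0 hz0'
  have e2 := lam2_eq_of_double_zero hh (eps_pos hc0) hz hz0 hz0'
  obtain ⟨b, hp⟩ := exists_isRootPair hh.le hc0 hz hz0
  rw [e2]
  exact hw.right_asymptotics_of_double hp (fun x hx => psi_neg_of_lam2_lt (e2.trans_lt hx)) hh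
    (quot_eq_zero_of_double hp.lt hp.psi_left hp.psi_right hz0')

end DelayedKPP

theorem theorem2 {m : ℕ} (h c : ℝ) (ν : Space m) (φ : ℝ → ℝ) (hh : 0 ≤ h)
    (hφ : IsPositiveMonotoneFront h c ν φ) :
    -- asymptotics at `t = -∞`
    ((c = 2 →
        ∃ t₀ K₂ : ℝ, 0 < K₂ ∧ ∀ᶠ σ : ℝ in 𝓝[>] 0,
          (fun t => φ (c * (t + t₀)) - (-(K₂ * t * Real.exp (lam c * t))))
            =O[atBot] fun t => Real.exp ((2 * lam c - σ) * t)) ∧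
      (2 < c → c < 3 / 2 * √2 →
        ∃ t₀ K₁ : ℝ, 0 < K₁ ∧ ∀ᶠ σ : ℝ in 𝓝[>] 0,
          (fun t => φ (c * (t + t₀)) - (Real.exp (lam c * t) - K₁ * Real.exp (mu c * t)))
            =O[atBot] fun t => Real.exp ((2 * lam c - σ) * t)) ∧
      (3 / 2 * √2 ≤ c →
        ∃ t₀ : ℝ, ∀ᶠ σ : ℝ in 𝓝[>] 0,
          (fun t => φ (c * (t + t₀)) - Real.exp (lam c * t))
            =O[atBot] fun t => Real.exp ((2 * lam c - σ) * t))) ∧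
    -- asymptotics at `t = +∞`
    ((h ≤ h0 → 2 ≤ c → (c : EReal) ≤ cSharp h →
        ∃ t₀ : ℝ, ∀ᶠ σ : ℝ in 𝓝[>] 0,
          (fun t => φ (c * (t + t₀)) - (1 - Real.exp (lam2 h c * t)))
            =O[atTop] fun t => Real.exp ((2 * lam2 h c + σ) * t)) ∧
      (Real.log 2 / 2 < h → h ≤ h1 → cSharp h < (c : EReal) → (c : EReal) < cStar h →
        ∃ t₀ K₃ : ℝ, 0 < K₃ ∧ ∀ᶠ σ : ℝ in 𝓝[>] 0,
          (fun t => φ (c * (t + t₀))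
              - (1 - Real.exp (lam2 h c * t) + K₃ * Real.exp (lam1 h c * t)))
            =O[atTop] fun t => Real.exp ((lam1 h c - σ) * t)) ∧
      (Real.exp (-1) < h → h ≤ h1 → (c : EReal) = cStar h →
        ∃ t₀ K₄ : ℝ, 0 < K₄ ∧ ∀ᶠ σ : ℝ in 𝓝[>] 0,
          (fun t => φ (c * (t + t₀)) - (1 - K₄ * t * Real.exp (lam2 h c * t)))
            =O[atTop] fun t => Real.exp ((lam2 h c - σ) * t))) := by
  refine ⟨⟨fun hc => ?_, fun hc hc' => ?_, fun hc => ?_⟩, fun hle hc hcs => ?_,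
    fun hlt _ hcs hcS => ?_, fun hlt _ hc => ?_⟩
  · subst hc
    have hsum := eps_mul_lam_add_mu (c := 2) two_pos
    have hprod := eps_mul_lam_mul_mu (c := 2) le_rfl
    rw [lam_two_eq_mu_two] at hsum hprod
    exact (hφ.isProfile two_pos).left_asymptotics_of_eq hh (eps_pos two_pos) (lam_pos le_rfl)
      hsum hprod
  · have hc0 : 0 < c := by linarith
    exact (hφ.isProfile hc0).left_asymptotics_of_lt_two_mul hh (eps_pos hc0) (lam_pos hc.le)
      (lam_lt_mu hc) (mu_lt_two_mul_lam hc hc') (eps_mul_lam_add_mu hc0)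
      (eps_mul_lam_mul_mu hc.le)
  · have hc2 := two_le_of_le hc
    have hc0 : 0 < c := by linarith
    exact (hφ.isProfile hc0).left_asymptotics_of_two_mul_le hh (eps_pos hc0) (lam_pos hc2)
      (two_mul_lam_le_mu hc) (eps_mul_lam_add_mu hc0) (eps_mul_lam_mul_mu hc2)
  · have hc0 : 0 < c := by linarith
    rcases le_or_gt h (Real.log 2 / 2) with hln | hln
    · obtain ⟨hne, hz⟩ := exists_psi_nonneg_of_delay_le hh hc0 hln
      exact (hφ.isProfile hc0).right_asymptotics_of_psi_nonneg hh hc0 hne hz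
    · obtain ⟨hne, hz⟩ := exists_psi_nonneg_of_epsSharp_le hln (epsSharp_le_eps hc0 hln hle hcs)
      exact (hφ.isProfile hc0).right_asymptotics_of_psi_nonneg hh hc0 hne hz
  · have hc0 : 0 < c := EReal.coe_pos.1 ((cSharp_nonneg h).trans_lt hcs)
    exact (hφ.isProfile hc0).right_asymptotics_of_mem_Ioo hc0 hlt hcs hcS
  · rw [cStar, if_neg hlt.not_ge, EReal.coe_eq_coe_iff] at hc
    have hc0 : 0 < c := by
      rw [hc]
      have := (exists_double_zero hlt).1
      positivity
    exact (hφ.isProfile hc0).right_asymptotics_of_eq_cStar hlt hc
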